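/- **Setting.** Let $\Omega$ be a finite alphabet with $q=|\Omega|\ge 2$, let $3\le\tau\le K$ be integers, and let $\mathrm{SMALL}$ and $\zeta$ be reals with $1\le \mathrm{SMALL}\le n/2$, $0<\zeta<1$ and $K\le\zeta\cdot\mathrm{SMALL}$. Let $G$ be a finite bipartite factor graph with $n$ variable-vertices and finitely many constraint-vertices. Each constraint-vertex $f$ has a neighbourhood $N(f)$ with $\tau-1\le|N(f)|\le K$ and carries a probability distribution $\mu_f$ on $\Omega^{N(f)}$ that is $(\tau-1)$-wise uniform (its marginal on every set of $\tau-1$ coordinates is uniform). A subgraph $H$ of $G$ is an edge-induced subgraph (possibly empty); $\mathrm{vbls}(H)$, $\mathrm{cons}(H)$, $\mathrm{edges}(H)$ are its sets of variable-vertices, constraint-vertices and edges. It is *small* if $|\mathrm{cons}(H)|\le\mathrm{SMALL}$, and a *$\tau$-subgraph* if each of its constraint-vertices has degree at least $\tau$ in $H$. *Plausibility Assumption*: every $\tau$-subgraph $H$ with $|\mathrm{cons}(H)|\le 2\cdot\mathrm{SMALL}$ satisfies $(\tau-\zeta)\,|\mathrm{cons}(H)|\ge 2(|\mathrm{edges}(H)|-|\mathrm{vbls}(H)|)$.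 For a set $S$ of variables, the closure $\mathrm{cl}(S)$ is the union of all small $\tau$-subgraphs all of whose variable-vertices of degree $1$ lie in $S$. For a subgraph $H$, the planted distribution $\eta_H$ on $\Omega^n$ is the following: draw $w_f\sim\mu_f$ independently for $f\in\mathrm{cons}(H)$, let each edge $(f,i)$ of $H$ suggest the value $w_{f,i}$ for variable $i$, condition on all suggestions being consistent, give each $i\in\mathrm{vbls}(H)$ its suggested value, and choose the other variables independently and uniformly. Introduce indeterminates $x_{i,c}$ for each variable $i$ and $c\in\Omega$, evaluated at an assignment $x\in\Omega^n$ as $1$ if $x_i=c$ and $0$ otherwise. For a polynomial $p$, its *multilinear-degree* is the largest number of distinct variables $i$ occurring in one of its monomials. Let $\widetilde{\mathbf E}$ be the linear functional on real polynomials of multilinear-degree at most $\zeta\cdot\mathrm{SMALL}$ with $\widetilde{\mathbf E}[M]=\mathbf E_{x\sim\eta_{\mathrm{cl}(\mathrm{vbls}(M))}}[M(x)]$ for every monomial $M$, where $\mathrm{vbls}(M)$ is the set of variables $i$ occurring in $M$. It *satisfies the identity* $p=0$ if $\widetilde{\mathbf E}[pq]=0$ for all polynomials $q$ with $\deg(pq)\le\zeta\cdot\mathrm{SMALL}$.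 **Theorem.** Under the Plausibility Assumption: 1. $\widetilde{\mathbf E}$ is well defined: for every set $S$ of at most $\zeta\cdot\mathrm{SMALL}$ variables, $\mathrm{cl}(S)$ is small and the event conditioned on in the definition of $\eta_{\mathrm{cl}(S)}$ has positive probability. Moreover $\widetilde{\mathbf E}[1]=1$. 2. For every integer $0\le D\le\frac13\zeta\cdot\mathrm{SMALL}$ and every polynomial $p$ of degree at most $D$, $\widetilde{\mathbf E}[p^2]\ge 0$. 3. $\widetilde{\mathbf E}$ satisfies the identities $\sum_{c\in\Omega}x_{i,c}=1$ for every variable $i$, and $x_{i,c}^2=x_{i,c}$ for every variable $i$ and every $c\in\Omega$. Consequently $\widetilde{\mathbf E}[p]=\widetilde{\mathbf E}[\mathrm{multilin}(p)]$ for every $p$ of multilinear-degree at most $\zeta\cdot\mathrm{SMALL}$, where $\mathrm{multilin}(p)$ is obtained by replacing every positive power of an indeterminate $x_{i,c}$ in $p$ by $x_{i,c}$. 4. For every constraint-vertex $f$, $\widetilde{\mathbf E}$ satisfies the identity $\sum_{c\in\mathrm{supp}(\mu_f)}\prod_{i\in N(f)}x_{i,c_i}=1$. -/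

import Mathlib

noncomputable section

/-- A distribution on `Ω^A` is `t`-wise uniform if its marginal on every set of `t`
coordinates is the uniform distribution. -/
def IsTWiseUniform {A Ω : Type*} [DecidableEq A] [Fintype Ω] [Nonempty Ω]
    (t : ℕ) (ν : PMF (A → Ω)) : Prop :=
  ∀ T : Finset A, T.card = t →
    ν.map (fun w => T.restrict w) = PMF.uniformOfFintype (T → Ω)

/-- An instance: a bipartite factor graph between constraint-vertices `F` and variable-vertices
`V`, given by the neighbourhoods `nbr f`, and for each constraint-vertex `f` a probability
distribution on the assignments of alphabet symbols to its neighbours. -/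
structure CSPInstance (V F Ω : Type*) where
  nbr : F → Finset V
  μ : (f : F) → PMF ((nbr f) → Ω)

/-! ### Edge-induced subgraphs, identified with sets of edges -/

section Subgraph

variable {V F : Type*} [DecidableEq V] [DecidableEq F]

/-- The constraint-vertices of the subgraph with edge set `H`. -/
def cons (H : Finset (F × V)) : Finset F := H.image Prod.fst

/-- The variable-vertices of the subgraph with edge set `H`. -/
def vbls (H : Finset (F × V)) : Finset V := H.image Prod.snd

/-- The degree of the constraint-vertex `f` inside `H`. -/
def consDegree (H : Finset (F × V)) (f : F) : ℕ := (H.filter (fun e => e.1 = f)).card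

/-- The degree of the variable-vertex `i` inside `H`. -/
def vblDegree (H : Finset (F × V)) (i : V) : ℕ := (H.filter (fun e => e.2 = i)).card

/-- At most `SMALL` constraint-vertices. -/
def IsSmall (SMALL : ℝ) (H : Finset (F × V)) : Prop := ((cons H).card : ℝ) ≤ SMALL

end Subgraph

/-! ### Polynomials in the indeterminates `x_{i,c}`, indexed by `(i, c) : V × Ω` -/

section Polynomials

variable {V Ω : Type*} [DecidableEq V] [DecidableEq Ω]

/-- The variables `i` such that some `x_{i,c}` occurs in the monomial with exponent `M`. -/
def monomialVbls (M : (V × Ω) →₀ ℕ) : Finset V := M.support.image Prod.fst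

/-- The multilinear-degree of a polynomial: the largest number of variables `i` occurring in one
of its monomials. -/
def mlinDegree (p : MvPolynomial (V × Ω) ℝ) : ℕ :=
  p.support.sup fun M => (monomialVbls M).card

/-- Replace every positive power of an indeterminate by its first power, in each monomial. -/
def multilin : MvPolynomial (V × Ω) ℝ →ₗ[ℝ] MvPolynomial (V × Ω) ℝ :=
  (MvPolynomial.basisMonomials (V × Ω) ℝ).constr ℝ
    fun M => ∏ e ∈ M.support, (MvPolynomial.X e : MvPolynomial (V × Ω) ℝ)

/-- The values of the indeterminates at an assignment `x`: `x_{i,c} = 1` if `x i = c`, and `0`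
otherwise. -/
def indicatorPoint (x : V → Ω) : V × Ω → ℝ := fun e => if x e.1 = e.2 then 1 else 0

/-- The linear functional `E` satisfies the polynomial identity `p = 0` up to degree `d`. -/
def SatisfiesIdentity {σ : Type*} (E : MvPolynomial σ ℝ →ₗ[ℝ] ℝ) (d : ℝ)
    (p : MvPolynomial σ ℝ) : Prop :=
  ∀ q : MvPolynomial σ ℝ, ((p * q).totalDegree : ℝ) ≤ d → E (p * q) = 0

end Polynomials

namespace CSPInstance

variable {V F Ω : Type*} [Fintype V] [DecidableEq V] [Fintype F] [DecidableEq F]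
  [Fintype Ω] [DecidableEq Ω]

/-- The edges of the factor graph. Subgraphs are exactly the subsets of this set. -/
def edges (I : CSPInstance V F Ω) : Finset (F × V) :=
  Finset.univ.filter fun e => e.2 ∈ I.nbr e.1

/-- `H` is a subgraph of the factor graph in which every constraint-vertex has degree at least
`τ`. -/
def IsTauSubgraph (I : CSPInstance V F Ω) (τ : ℕ) (H : Finset (F × V)) : Prop :=
  H ⊆ I.edges ∧ ∀ f ∈ cons H, τ ≤ consDegree H f

/-- The Plausibility Assumption. -/
def Plausible (I : CSPInstance V F Ω) (τ : ℕ) (ζ SMALL : ℝ) : Prop :=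
  ∀ H : Finset (F × V), I.IsTauSubgraph τ H → ((cons H).card : ℝ) ≤ 2 * SMALL →
    2 * ((H.card : ℝ) - ((vbls H).card : ℝ)) ≤ ((τ : ℝ) - ζ) * ((cons H).card : ℝ)

/-- `S`-closed: a `τ`-subgraph all of whose leaf variable-vertices (those of degree one) lie
in `S`. -/
def IsClosedSubgraph (I : CSPInstance V F Ω) (τ : ℕ) (S : Finset V) (H : Finset (F × V)) : Prop :=
  I.IsTauSubgraph τ H ∧ ∀ i, vblDegree H i = 1 → i ∈ S

open Classical in
/-- The closure of `S`: the union of all small `S`-closed subgraphs. -/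
def cl (I : CSPInstance V F Ω) (τ : ℕ) (SMALL : ℝ) (S : Finset V) : Finset (F × V) :=
  (I.edges.powerset.filter fun H => I.IsClosedSubgraph τ S H ∧ IsSmall SMALL H).biUnion id

/-! ### The planted distribution

A family `w` of suggestions consists of an assignment `w f` to the neighbours of `f`, for every
`f`, drawn independently from the distributions `μ f`. (For a subgraph `H` only the values
`w f i` with `(f, i)` an edge of `H` matter; drawing `w f` also for the constraint-vertices
outside `H` changes none of the probabilities below.) -/

/-- The probability of drawing the suggestions `w`. -/
def suggestionProb (I : CSPInstance V F Ω) (w : (f : F) → I.nbr f → Ω) : ℝ :=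
  ∏ f, (I.μ f (w f)).toReal

/-- Any two suggestions made along edges of `H` for the same variable are equal. -/
def Consistent (I : CSPInstance V F Ω) (H : Finset (F × V)) (w : (f : F) → I.nbr f → Ω) : Prop :=
  ∀ (f : F) (i : I.nbr f) (g : F) (j : I.nbr g),
    (f, (i : V)) ∈ H → (g, (j : V)) ∈ H → (i : V) = (j : V) → w f i = w g j

/-- Every suggestion made along an edge of `H` is the value given by `x`. -/
def Agrees (I : CSPInstance V F Ω) (H : Finset (F × V)) (w : (f : F) → I.nbr f → Ω)
    (x : V → Ω) : Prop :=
  ∀ (f : F) (i : I.nbr f), (f, (i : V)) ∈ H → w f i = x i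

open Classical in
/-- The probability that the suggestions are consistent on `H`. -/
def consistentProb (I : CSPInstance V F Ω) (H : Finset (F × V)) : ℝ :=
  ∑ w : (f : F) → I.nbr f → Ω, if I.Consistent H w then I.suggestionProb w else 0

open Classical in
/-- The probability that the suggestions are consistent on `H` and that the assignment to the
variables of `H` they agree on is the restriction of `x`. -/
def agreeProb (I : CSPInstance V F Ω) (H : Finset (F × V)) (x : V → Ω) : ℝ :=
  ∑ w : (f : F) → I.nbr f → Ω, if I.Agrees H w x then I.suggestionProb w else 0

/-- The probability of the assignment `x` under the planted distribution on `H`: the variables of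
`H` take the values suggested, conditioned on consistency; all other variables are independent and
uniform. -/
def planted (I : CSPInstance V F Ω) (H : Finset (F × V)) (x : V → Ω) : ℝ :=
  I.agreeProb H x / I.consistentProb H *
    (1 / (Fintype.card Ω : ℝ)) ^ (Fintype.card V - (vbls H).card)

/-- Expectation under the planted distribution on `H`. -/
def plantedExp (I : CSPInstance V F Ω) (H : Finset (F × V)) (g : (V → Ω) → ℝ) : ℝ :=
  ∑ x : V → Ω, I.planted H x * g x

/-- The closure-based pseudoexpectation: the linear map whose value on a monomial is the
expectation of the monomial under the planted distribution on the closure of its variables. It is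
meant to be applied to polynomials of multilinear-degree at most `ζ * SMALL` only; on other
monomials its values are irrelevant. -/
def pseudoexp (I : CSPInstance V F Ω) (τ : ℕ) (SMALL : ℝ) :
    MvPolynomial (V × Ω) ℝ →ₗ[ℝ] ℝ :=
  (MvPolynomial.basisMonomials (V × Ω) ℝ).constr ℝ fun M =>
    I.plantedExp (I.cl τ SMALL (monomialVbls M))
      fun x => MvPolynomial.eval (indicatorPoint x) (MvPolynomial.monomial M (1 : ℝ))

open Classical in
/-- The arithmetization of "the assignment to the neighbours of `f` lies in the support of
`μ f`". -/
def supportPoly (I : CSPInstance V F Ω) (f : F) : MvPolynomial (V × Ω) ℝ :=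
  ∑ c : I.nbr f → Ω,
    if c ∈ (I.μ f).support then ∏ i : I.nbr f, MvPolynomial.X ((i : V), c i) else 0

end CSPInstance

end

set_option linter.unusedSectionVars false

noncomputable section

/-! ### Sums over the cube `V → Ω` -/

section Cube

variable {V Ω : Type*} [Fintype V] [DecidableEq V] [Fintype Ω]

/-! Write q = |Ω| and n = |V|. For small H, q^n times the planted probability is the product over f
of the marginal density of μ_f on the H-neighbours of f. Möbius inversion splits each marginal
density into pure parts, which have mean zero in each of their coordinates, so the density of H is
the sum over G ⊆ H of the products `pureProd G`. By (τ-1)-wise uniformity such a product vanishes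
unless G is a τ-subgraph, and it integrates to zero against functions of S unless every leaf
variable of G lies in S. Only S-closed G contribute, so all closures can be replaced by one object:
the pseudoexpectation is q^(-n) times summation against `signedDensity`, the sum of the pure
products of all small τ-subgraphs (`sum_signedDensity_mul`, `pseudoexp_eq_sum_signedDensity`).
Against functions of S it acts as the genuine density of any small G containing cl(S).

Smallness rests on `potential`, 2|vbls H ∪ S| + τ|cons H| - 2|H|. Plausibility bounds it below by
ζ|cons H|, while counting edges bounds its growth when a closed subgraph is added
(`potential_add_card_le`). Hence unions of small closed subgraphs remain small, and a nonempty small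
τ-subgraph has a leaf, which gives total mass q^n and positive consistency probability.

Positivity is a Gram–Schmidt argument. Remove a largest set S from the family of variable sets in
play and let C be a small τ-subgraph of minimal potential, with as many edges as possible among
those. Project the S-part of the function, with weight `density C`, onto the span of the remaining
local functions living on vbls C ∪ S. The residual is then orthogonal under the signed density to
every remaining local function (`sum_signedDensity_mul_eq_zero`): any further closed piece strictly
raises the potential, so it meets vbls C ∪ S in too few variables to correlate with the residual.
The square of the residual has nonnegative integral against a genuine density, and the rest follows
by induction.

The identities in the indicators hold pointwise on assignments. For the constraint identity, the
closure of any set containing N(f) contains the star of f, unless |N(f)| = τ-1, when μ_f is uniform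
and has full support. -/

theorem DependsOn.update_eq {V Ω β : Type*} [DecidableEq V] {g : (V → Ω) → β}
    {S : Set V} (hg : DependsOn g S) {i : V} (hi : i ∉ S) (x : V → Ω) (c : Ω) :
    g (Function.update x i c) = g x := by
  apply hg
  intro j hj
  have : j ≠ i := fun h => hi (h ▸ hj)
  simp [this]

theorem sum_eq_zero_of_sum_update_eq_zero {i : V} (F : (V → Ω) → ℝ)
    (h : ∀ x, ∑ c, F (Function.update x i c) = 0) : ∑ x, F x = 0 := by
  classical
  rw [← (Equiv.funSplitAt i Ω).symm.sum_comp F, Fintype.sum_prod_type_right]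
  refine Finset.sum_eq_zero fun y _ => ?_
  rcases isEmpty_or_nonempty Ω with hΩ | ⟨⟨c₀⟩⟩
  · simp
  rw [← h ((Equiv.funSplitAt i Ω).symm (c₀, y))]
  refine Finset.sum_congr rfl fun c _ => ?_
  congr 1
  ext j
  by_cases hj : j = i
  · subst hj; simp [Equiv.funSplitAt, Equiv.piSplitAt]
  · simp [Equiv.funSplitAt, Equiv.piSplitAt, hj]

theorem sum_mul_eq_zero_of_dependsOn {i : V} {F g : (V → Ω) → ℝ} {S : Set V}
    (hF : ∀ x, ∑ c, F (Function.update x i c) = 0) (hg : DependsOn g S) (hi : i ∉ S) :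
    ∑ x, F x * g x = 0 := by
  refine sum_eq_zero_of_sum_update_eq_zero (i := i) _ fun x => ?_
  simp_rw [hg.update_eq hi, ← Finset.sum_mul, hF, zero_mul]

/-- Swapping the coordinates outside `A` between two points. -/
def swapOutside (A : Finset V) : ((V → Ω) × (V → Ω)) ≃ ((V → Ω) × (V → Ω)) where
  toFun z := (A.piecewise z.1 z.2, A.piecewise z.2 z.1)
  invFun z := (A.piecewise z.1 z.2, A.piecewise z.2 z.1)
  left_inv z := by
    ext i <;> by_cases hi : i ∈ A <;> simp [hi]
  right_inv z := by
    ext i <;> by_cases hi : i ∈ A <;> simp [hi]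

/-- Averaging a function over the coordinates outside `A`. -/
theorem exists_conditional_expectation [Nonempty Ω] (A : Finset V) {B : Set V} {b : (V → Ω) → ℝ}
    (hb : DependsOn b B) :
    ∃ k : (V → Ω) → ℝ, DependsOn k (A ∩ B : Set V) ∧
      ∀ a : (V → Ω) → ℝ, DependsOn a (A : Set V) → ∑ x, a x * b x = ∑ x, a x * k x := by
  classical
  obtain ⟨N, hN⟩ : ∃ N : ℝ, N = Fintype.card (V → Ω) := ⟨_, rfl⟩
  have hN0 : N ≠ 0 := by rw [hN]; exact_mod_cast Fintype.card_ne_zero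
  refine ⟨fun x => N⁻¹ * ∑ y, b (A.piecewise x y), ?_, fun a ha => ?_⟩
  · intro x x' h
    simp only
    congr 1
    refine Finset.sum_congr rfl fun y _ => hb fun i hi => ?_
    by_cases hA : i ∈ A
    · simp [hA, h i ⟨hA, hi⟩]
    · simp [hA]
  -- Duplicate the variables and resample everything outside A; the swap permutes the pairs and
  -- leaves `a z.1` unchanged.
  · have h1 : ∑ z : (V → Ω) × (V → Ω), a z.1 * b z.1 =
        ∑ z : (V → Ω) × (V → Ω), a z.1 * b (A.piecewise z.1 z.2) := by
      rw [← (swapOutside A).sum_comp]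
      refine Finset.sum_congr rfl fun z _ => ?_
      simp only [swapOutside, Equiv.coe_fn_mk]
      congr 1
      exact ha fun i hi => by simp [Finset.mem_coe.1 hi]
    rw [Fintype.sum_prod_type, Fintype.sum_prod_type] at h1
    simp only [Finset.sum_const, Finset.card_univ, nsmul_eq_mul, ← Finset.mul_sum] at h1
    rw [← hN] at h1
    have : ∑ x, a x * (N⁻¹ * ∑ y, b (A.piecewise x y)) =
        N⁻¹ * ∑ x, a x * ∑ y, b (A.piecewise x y) := by
      rw [Finset.mul_sum]
      exact Finset.sum_congr rfl fun x _ => by ring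
    rw [this, ← h1, inv_mul_cancel_left₀ hN0]

/-- The functions of the coordinates in `S`. -/
def localFunctions {V : Type*} (Ω : Type*) (S : Finset V) : Submodule ℝ ((V → Ω) → ℝ) where
  carrier := {g | DependsOn g (S : Set V)}
  add_mem' ha hb x y h := by simp [ha h, hb h]
  zero_mem' _ _ _ := rfl
  smul_mem' c _ ha x y h := by simp [ha h]

/-- Orthogonal projection with respect to a nonnegative weight. -/
theorem exists_weighted_projection {X : Type*} [Fintype X] (W : Submodule ℝ (X → ℝ))
    (D : X → ℝ) (hD : ∀ x, 0 ≤ D x) (g : X → ℝ) :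
    ∃ h ∈ W, ∀ k ∈ W, ∑ x, D x * ((g x - h x) * k x) = 0 := by
  -- Scaling by √D turns the weighted form into the Euclidean one. Since D may vanish somewhere, s
  -- need not be injective; the projection is taken in the image of W and any preimage serves.
  let s : (X → ℝ) →ₗ[ℝ] EuclideanSpace ℝ X :=
    { toFun := fun u => WithLp.toLp 2 fun x => √(D x) * u x
      map_add' := fun u v => by ext x; simp [mul_add]
      map_smul' := fun c u => by ext x; simp; ring }
  obtain ⟨y, hy, z, hz, hyz⟩ := (W.map s).exists_add_mem_mem_orthogonal (s g)
  obtain ⟨h, hh, rfl⟩ := Submodule.mem_map.1 hy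
  refine ⟨h, hh, fun k hk => ?_⟩
  have h1 := (Submodule.mem_orthogonal _ _).1 hz (s k) (Submodule.mem_map_of_mem hk)
  have h2 : z = s g - s h := by rw [hyz]; abel
  rw [h2, PiLp.inner_apply] at h1
  rw [← h1]
  refine Finset.sum_congr rfl fun x _ => ?_
  simp only [s, LinearMap.coe_mk, AddHom.coe_mk, PiLp.sub_apply, RCLike.inner_apply, conj_trivial]
  linear_combination -(Real.mul_self_sqrt (hD x)) * ((g x - h x) * k x)

end Cube

/-! ### Möbius inversion on finite sets -/

section Moebius

variable {V : Type*} [DecidableEq V]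

/-- The Möbius transform of a set function. -/
def moebiusSum (u : Finset V → ℝ) (B : Finset V) : ℝ :=
  ∑ C ∈ B.powerset, (-1) ^ (B.card + C.card) * u C

theorem moebiusSum_insert (u : Finset V → ℝ) {a : V} {B : Finset V} (ha : a ∉ B) :
    moebiusSum u (insert a B) = moebiusSum (fun C => u (insert a C)) B - moebiusSum u B := by
  unfold moebiusSum
  rw [Finset.sum_powerset_insert ha, Finset.card_insert_of_notMem ha, sub_eq_neg_add,
    ← Finset.sum_neg_distrib]
  congr 1
  · exact Finset.sum_congr rfl fun C _ => by ring
  · refine Finset.sum_congr rfl fun C hC => ?_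
    rw [Finset.card_insert_of_notMem fun h => ha (Finset.mem_powerset.1 hC h)]
    ring

theorem sum_moebiusSum (u : Finset V → ℝ) (A : Finset V) :
    ∑ B ∈ A.powerset, moebiusSum u B = u A := by
  induction A using Finset.induction_on generalizing u with
  | empty => simp [moebiusSum]
  | insert a A ha ih =>
    rw [Finset.sum_powerset_insert ha, ← Finset.sum_add_distrib, ← ih fun C => u (insert a C)]
    refine Finset.sum_congr rfl fun B hB => ?_
    rw [moebiusSum_insert u fun h => ha (Finset.mem_powerset.1 hB h)]
    ring

/-- Subsets with and without a fixed element cancel in pairs. This kills the pure parts on nonempty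
sets of fewer than τ neighbours. -/
theorem moebiusSum_const_one {u : Finset V → ℝ} {B : Finset V} (hB : B.Nonempty)
    (hu : ∀ C ⊆ B, u C = 1) : moebiusSum u B = 0 := by
  obtain ⟨a, ha⟩ := hB
  rw [← Finset.insert_erase ha, moebiusSum_insert u (Finset.notMem_erase a B), sub_eq_zero]
  unfold moebiusSum
  refine Finset.sum_congr rfl fun C hC => ?_
  have hC' := (Finset.mem_powerset.1 hC).trans (Finset.erase_subset a B)
  simp only [hu _ (Finset.insert_subset ha hC'), hu _ hC']

end Moebius

end

noncomputable section

/-! ### Combinatorics of edge sets -/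

section EdgeSets

variable {V F : Type*} [DecidableEq V] [DecidableEq F]

/-- The neighbours of the constraint-vertex `f` inside `H`. -/
def nbrIn (H : Finset (F × V)) (f : F) : Finset V := (H.filter fun e => e.1 = f).image Prod.snd

theorem mem_nbrIn {H : Finset (F × V)} {f : F} {i : V} : i ∈ nbrIn H f ↔ (f, i) ∈ H := by
  simp [nbrIn]

theorem card_nbrIn (H : Finset (F × V)) (f : F) : (nbrIn H f).card = consDegree H f := by
  unfold nbrIn consDegree
  refine Finset.card_image_of_injOn ?_
  rintro ⟨a, b⟩ ha ⟨c, d⟩ hc h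
  simp_all

theorem mem_cons_iff {H : Finset (F × V)} {f : F} : f ∈ cons H ↔ ∃ i, (f, i) ∈ H := by
  simp [cons]

theorem mem_vbls_iff {H : Finset (F × V)} {i : V} : i ∈ vbls H ↔ ∃ f, (f, i) ∈ H := by
  simp [vbls]

theorem nbrIn_eq_empty {H : Finset (F × V)} {f : F} (hf : f ∉ cons H) : nbrIn H f = ∅ := by
  ext i
  simp only [mem_nbrIn, Finset.notMem_empty, iff_false]
  exact fun h => hf (mem_cons_iff.2 ⟨i, h⟩)

theorem nbrIn_empty (f : F) : nbrIn (∅ : Finset (F × V)) f = ∅ := rfl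

theorem nbrIn_mono {G H : Finset (F × V)} (h : G ⊆ H) (f : F) : nbrIn G f ⊆ nbrIn H f :=
  fun _ hi => mem_nbrIn.2 (h (mem_nbrIn.1 hi))

theorem nbrIn_subset_vbls (H : Finset (F × V)) (f : F) : nbrIn H f ⊆ vbls H :=
  fun _ hi => mem_vbls_iff.2 ⟨f, mem_nbrIn.1 hi⟩

theorem cons_mono {G H : Finset (F × V)} (h : G ⊆ H) : cons G ⊆ cons H :=
  Finset.image_subset_image h

theorem cons_union (G H : Finset (F × V)) : cons (G ∪ H) = cons G ∪ cons H :=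
  Finset.image_union _ _

theorem vbls_union (G H : Finset (F × V)) : vbls (G ∪ H) = vbls G ∪ vbls H :=
  Finset.image_union _ _

theorem IsSmall.mono {SMALL : ℝ} {G H : Finset (F × V)} (hH : IsSmall SMALL H) (h : G ⊆ H) :
    IsSmall SMALL G := by
  have := Finset.card_le_card (cons_mono h)
  unfold IsSmall at *
  exact le_trans (by exact_mod_cast this) hH

theorem consDegree_mono {G H : Finset (F × V)} (h : G ⊆ H) (f : F) :
    consDegree G f ≤ consDegree H f :=
  Finset.card_le_card (Finset.filter_subset_filter _ h)

theorem vblDegree_mono {G H : Finset (F × V)} (h : G ⊆ H) (i : V) :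
    vblDegree G i ≤ vblDegree H i :=
  Finset.card_le_card (Finset.filter_subset_filter _ h)

theorem vblDegree_pos {H : Finset (F × V)} {i : V} : 0 < vblDegree H i ↔ i ∈ vbls H := by
  simp [vblDegree, Finset.card_pos, vbls, Finset.Nonempty]

theorem exists_unique_nbr_of_vblDegree_eq_one {H : Finset (F × V)} {i : V}
    (h : vblDegree H i = 1) : ∃ f, i ∈ nbrIn H f ∧ ∀ g, g ≠ f → i ∉ nbrIn H g := by
  obtain ⟨⟨f, j⟩, he⟩ := Finset.card_eq_one.1 h
  have hmem : ∀ e, e ∈ H.filter (fun e => e.2 = i) ↔ e = (f, j) := fun e => by rw [he]; simp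
  have h1 := (hmem (f, j)).2 rfl
  simp only [Finset.mem_filter] at h1
  obtain ⟨h1, rfl⟩ := h1
  refine ⟨f, mem_nbrIn.2 h1, fun g hg hgi => hg ?_⟩
  have := (hmem (g, j)).1 (by simpa using mem_nbrIn.1 hgi)
  exact congrArg Prod.fst this

theorem card_eq_sum_consDegree (H : Finset (F × V)) : H.card = ∑ f ∈ cons H, consDegree H f :=
  Finset.card_eq_sum_card_image _ _

theorem card_eq_sum_vblDegree (H : Finset (F × V)) : H.card = ∑ i ∈ vbls H, vblDegree H i :=
  Finset.card_eq_sum_card_image _ _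

/-- Expanding a product over the constraint-vertices of sums over sets of neighbours into a sum
over subgraphs. -/
theorem prod_sum_powerset_nbrIn [Fintype F] (H : Finset (F × V)) (ψ : F → Finset V → ℝ) :
    ∏ f, ∑ B ∈ (nbrIn H f).powerset, ψ f B = ∑ G ∈ H.powerset, ∏ f, ψ f (nbrIn G f) := by
  rw [Finset.prod_univ_sum]
  symm
  refine Finset.sum_bij' (fun G _ f => nbrIn G f)
    (fun p _ => H.filter fun e => e.2 ∈ p e.1) ?_ ?_ ?_ ?_ ?_
  · intro G hG
    simpa using fun f => nbrIn_mono (Finset.mem_powerset.1 hG) f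
  · intro p _
    simp
  · intro G hG
    ext ⟨f, i⟩
    simp only [Finset.mem_filter, mem_nbrIn]
    exact ⟨fun h => h.2, fun h => ⟨Finset.mem_powerset.1 hG h, h⟩⟩
  · intro p hp
    funext f
    ext i
    simp only [mem_nbrIn, Finset.mem_filter]
    have := Finset.mem_powerset.1 (Fintype.mem_piFinset.1 hp f)
    exact ⟨fun h => h.2, fun h => ⟨mem_nbrIn.1 (this h), h⟩⟩
  · intro G _
    rfl

end EdgeSets

namespace CSPInstance

variable {V F Ω : Type*} [Fintype V] [DecidableEq V] [Fintype F] [DecidableEq F]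
  [Fintype Ω] [DecidableEq Ω]

theorem mem_edges {I : CSPInstance V F Ω} {e : F × V} : e ∈ I.edges ↔ e.2 ∈ I.nbr e.1 := by
  simp [edges]

theorem nbrIn_subset_nbr {I : CSPInstance V F Ω} {H : Finset (F × V)} (hH : H ⊆ I.edges) (f : F) :
    nbrIn H f ⊆ I.nbr f :=
  fun _ hi => mem_edges.1 (hH (mem_nbrIn.1 hi))

/-! ### Marginal densities of a constraint and their pure parts -/

open Classical in
/-- The probability under `μ f` that the coordinates in `A` agree with `x`. -/
def marginalProb (I : CSPInstance V F Ω) (f : F) (A : Finset V) (x : V → Ω) : ℝ :=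
  ∑ w : I.nbr f → Ω, if ∀ i : I.nbr f, (i : V) ∈ A → w i = x i then (I.μ f w).toReal else 0

/-- The density, relative to the uniform distribution, of the marginal of `μ f` on `A`. -/
def marginalDensity (I : CSPInstance V F Ω) (f : F) (x : V → Ω) (A : Finset V) : ℝ :=
  (Fintype.card Ω : ℝ) ^ A.card * I.marginalProb f A x

/-- The part of the marginal densities of `μ f` that depends on the coordinates in `B` and has
mean zero in each of them. -/
def pureDensity (I : CSPInstance V F Ω) (f : F) (x : V → Ω) (B : Finset V) : ℝ :=
  moebiusSum (I.marginalDensity f x) B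

/-- The product over the constraints of the densities of the marginals along `H`. -/
def density (I : CSPInstance V F Ω) (H : Finset (F × V)) (x : V → Ω) : ℝ :=
  ∏ f, I.marginalDensity f x (nbrIn H f)

/-- The product over the constraints of the pure parts along `H`. -/
def pureProd (I : CSPInstance V F Ω) (H : Finset (F × V)) (x : V → Ω) : ℝ :=
  ∏ f, I.pureDensity f x (nbrIn H f)

variable (I : CSPInstance V F Ω)

theorem marginalProb_nonneg (f : F) (A : Finset V) (x : V → Ω) : 0 ≤ I.marginalProb f A x := by
  unfold marginalProb
  refine Finset.sum_nonneg fun w _ => ?_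
  split_ifs <;> simp

theorem density_nonneg (H : Finset (F × V)) (x : V → Ω) : 0 ≤ I.density H x :=
  Finset.prod_nonneg fun f _ => mul_nonneg (by positivity) (I.marginalProb_nonneg f _ x)

theorem sum_μ_toReal (f : F) : ∑ w : I.nbr f → Ω, (I.μ f w).toReal = 1 := by
  rw [← ENNReal.toReal_sum fun w _ => (I.μ f).apply_ne_top w,
    ← tsum_fintype (L := .unconditional _), (I.μ f).tsum_coe]
  rfl

theorem marginalDensity_empty (f : F) (x : V → Ω) : I.marginalDensity f x ∅ = 1 := by
  simp [marginalDensity, marginalProb, sum_μ_toReal]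

theorem dependsOn_marginalDensity (f : F) (A : Finset V) :
    DependsOn (fun x => I.marginalDensity f x A) (A : Set V) := by
  intro x y h
  simp only [marginalDensity, marginalProb]
  refine congrArg _ (Finset.sum_congr rfl fun w _ => ?_)
  refine if_congr (forall_congr' fun i => imp_congr_right fun hi => by rw [h i hi]) rfl rfl

theorem dependsOn_pureDensity (f : F) (B : Finset V) :
    DependsOn (fun x => I.pureDensity f x B) (B : Set V) := by
  intro x y h
  unfold pureDensity moebiusSum
  refine Finset.sum_congr rfl fun C hC => ?_
  congr 1
  exact I.dependsOn_marginalDensity f C fun i hi => h i (Finset.mem_powerset.1 hC hi)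

theorem dependsOn_density (H : Finset (F × V)) : DependsOn (I.density H) (vbls H : Set V) := by
  intro x y h
  exact Finset.prod_congr rfl fun f _ => I.dependsOn_marginalDensity f _ fun i hi =>
    h i (nbrIn_subset_vbls H f hi)

theorem dependsOn_pureProd (H : Finset (F × V)) : DependsOn (I.pureProd H) (vbls H : Set V) := by
  intro x y h
  exact Finset.prod_congr rfl fun f _ => I.dependsOn_pureDensity f _ fun i hi =>
    h i (nbrIn_subset_vbls H f hi)

theorem sum_marginalProb_update {f : F} {i : V} (hi : i ∈ I.nbr f) {A : Finset V} (hA : i ∉ A)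
    (x : V → Ω) :
    ∑ c, I.marginalProb f (insert i A) (Function.update x i c) = I.marginalProb f A x := by
  classical
  unfold marginalProb
  rw [Finset.sum_comm]
  refine Finset.sum_congr rfl fun w _ => ?_
  have key : ∀ c, (∀ j : I.nbr f, (j : V) ∈ insert i A → w j = Function.update x i c j) ↔
      c = w ⟨i, hi⟩ ∧ ∀ j : I.nbr f, (j : V) ∈ A → w j = x j := by
    intro c
    constructor
    · intro h
      refine ⟨by simpa using (h ⟨i, hi⟩ (by simp)).symm, fun j hj => ?_⟩
      have hji : (j : V) ≠ i := fun h => hA (h ▸ hj)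
      simpa [hji] using h j (by simp [hj])
    · rintro ⟨rfl, h⟩ j hj
      by_cases hji : (j : V) = i
      · obtain rfl : j = ⟨i, hi⟩ := Subtype.ext hji
        simp
      · simpa [hji] using h j (by simpa [hji] using hj)
  simp_rw [key, ite_and]
  simp

theorem sum_marginalDensity_update {f : F} {i : V} (hi : i ∈ I.nbr f) {A : Finset V}
    (hA : i ∉ A) (x : V → Ω) :
    ∑ c, I.marginalDensity f (Function.update x i c) (insert i A) =
      Fintype.card Ω * I.marginalDensity f x A := by
  unfold marginalDensity
  rw [← Finset.mul_sum, I.sum_marginalProb_update hi hA, Finset.card_insert_of_notMem hA]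
  ring

/-- Averaging over coordinate i turns the density on C ∪ {i} into the density on C, so the Möbius
terms of C and C ∪ {i} cancel. -/
theorem sum_pureDensity_update {f : F} {i : V} {B : Finset V} (hB : B ⊆ I.nbr f) (hi : i ∈ B)
    (x : V → Ω) : ∑ c, I.pureDensity f (Function.update x i c) B = 0 := by
  unfold pureDensity
  have hiB := Finset.notMem_erase i B
  rw [← Finset.insert_erase hi]
  simp_rw [moebiusSum_insert _ hiB, moebiusSum, ← Finset.sum_sub_distrib]
  rw [Finset.sum_comm]
  refine Finset.sum_eq_zero fun C hC => ?_
  have hiC : i ∉ C := fun h => hiB (Finset.mem_powerset.1 hC h)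
  simp_rw [← mul_sub]
  rw [← Finset.mul_sum, Finset.sum_sub_distrib, I.sum_marginalDensity_update (hB hi) hiC]
  have : ∀ c, I.marginalDensity f (Function.update x i c) C = I.marginalDensity f x C := fun c =>
    (I.dependsOn_marginalDensity f C).update_eq (by simpa using hiC) x c
  simp [this]

theorem density_eq_sum_pureProd (H : Finset (F × V)) (x : V → Ω) :
    I.density H x = ∑ G ∈ H.powerset, I.pureProd G x := by
  unfold density pureProd
  rw [← prod_sum_powerset_nbrIn]
  exact Finset.prod_congr rfl fun f _ => (sum_moebiusSum _ _).symm

/-- A leaf variable enters exactly one factor of the product, and that factor has mean zero in it.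
-/
theorem sum_pureProd_update {H : Finset (F × V)} (hH : H ⊆ I.edges) {i : V}
    (hi : vblDegree H i = 1) (x : V → Ω) : ∑ c, I.pureProd H (Function.update x i c) = 0 := by
  obtain ⟨f, hf, hg⟩ := exists_unique_nbr_of_vblDegree_eq_one hi
  unfold pureProd
  simp_rw [← Finset.mul_prod_erase Finset.univ _ (Finset.mem_univ f)]
  have : ∀ c, ∏ g ∈ Finset.univ.erase f, I.pureDensity g (Function.update x i c) (nbrIn H g) =
      ∏ g ∈ Finset.univ.erase f, I.pureDensity g x (nbrIn H g) := fun c =>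
    Finset.prod_congr rfl fun g hgf =>
      (I.dependsOn_pureDensity g _).update_eq (by simpa using hg g (Finset.ne_of_mem_erase hgf)) x c
  simp_rw [this]
  rw [← Finset.sum_mul, I.sum_pureDensity_update (nbrIn_subset_nbr hH f) hf, zero_mul]

/-! ### Uniform marginals -/

variable {τ : ℕ}

theorem marginalProb_of_uniform [Nonempty Ω] {f : F} {t : ℕ} (hu : IsTWiseUniform t (I.μ f))
    {A : Finset V} (hA : A ⊆ I.nbr f) (ht : A.card = t) (x : V → Ω) :
    (Fintype.card Ω : ℝ) ^ A.card * I.marginalProb f A x = 1 := by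
  classical
  set T : Finset (I.nbr f) := Finset.univ.filter fun i => (i : V) ∈ A with hT
  have hTA : T.map (Function.Embedding.subtype _) = A := by
    ext i
    simp only [hT, Finset.mem_map, Finset.mem_filter, Finset.mem_univ, true_and,
      Function.Embedding.subtype_apply]
    exact ⟨by rintro ⟨a, h, rfl⟩; exact h, fun h => ⟨⟨i, hA h⟩, h, rfl⟩⟩
  have hTc : T.card = A.card := by rw [← hTA, Finset.card_map]
  have h := congrArg (fun p => (p fun i : T => x i).toReal) (hu T (hTc.trans ht))
  simp only [PMF.map_apply, PMF.uniformOfFintype_apply] at h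
  rw [tsum_fintype, ENNReal.toReal_sum] at h
  · have h2 : I.marginalProb f A x =
        ((Fintype.card (T → Ω) : ENNReal)⁻¹).toReal := by
      rw [← h]
      unfold marginalProb
      refine Finset.sum_congr rfl fun w _ => ?_
      have : (∀ i : I.nbr f, (i : V) ∈ A → w i = x i) ↔
          (fun i : T => x i) = T.restrict w := by
        rw [funext_iff]
        constructor
        · intro h i
          exact (h i (by simpa [hT] using i.2)).symm
        · intro h i hi
          exact (h ⟨i, by simpa [hT] using hi⟩).symm
      simp only [this]
      split_ifs <;> rfl
    rw [h2]
    simp only [Fintype.card_fun, Fintype.card_coe, hTc, ENNReal.toReal_inv, ENNReal.toReal_natCast]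
    push_cast
    refine mul_inv_cancel₀ (pow_ne_zero _ ?_)
    exact_mod_cast Fintype.card_ne_zero
  · intro w _
    split_ifs
    · exact (I.μ f).apply_ne_top w
    · simp

/-- Smaller marginals are averages of marginals on τ-1 coordinates; the arity bound supplies the
coordinates to add. -/
theorem marginalDensity_eq_one [Nonempty Ω] {f : F} (hcard : τ - 1 ≤ (I.nbr f).card)
    (hu : IsTWiseUniform (τ - 1) (I.μ f)) {A : Finset V} (hA : A ⊆ I.nbr f)
    (hAc : A.card ≤ τ - 1) (x : V → Ω) : I.marginalDensity f x A = 1 := by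
  obtain ⟨d, hd⟩ := Nat.exists_eq_add_of_le hAc
  induction d generalizing A x with
  | zero => exact I.marginalProb_of_uniform hu hA hd.symm x
  | succ d ih =>
    obtain ⟨i, hi, hiA⟩ := Finset.exists_mem_notMem_of_card_lt_card
      (show A.card < (I.nbr f).card by omega)
    have hc : (insert i A).card = A.card + 1 := Finset.card_insert_of_notMem hiA
    have h := I.sum_marginalDensity_update hi hiA x
    have h2 : ∀ y, I.marginalDensity f y (insert i A) = 1 := fun y =>
      ih (Finset.insert_subset hi hA) (by omega) y (by omega)
    simp only [h2, Finset.sum_const, Finset.card_univ, nsmul_eq_mul] at h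
    have hq : (Fintype.card Ω : ℝ) ≠ 0 := by exact_mod_cast Fintype.card_ne_zero
    exact (mul_left_cancel₀ hq h).symm

theorem pureProd_empty (x : V → Ω) : I.pureProd ∅ x = 1 := by
  refine Finset.prod_eq_one fun f _ => ?_
  rw [nbrIn_empty]
  simp [pureDensity, moebiusSum, marginalDensity_empty]

theorem isTauSubgraph_of_pureProd_ne_zero [Nonempty Ω] (hτ : 0 < τ)
    (harity : ∀ f, τ - 1 ≤ (I.nbr f).card) (huniform : ∀ f, IsTWiseUniform (τ - 1) (I.μ f))
    {H : Finset (F × V)} (hH : H ⊆ I.edges) {x : V → Ω} (hx : I.pureProd H x ≠ 0) :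
    I.IsTauSubgraph τ H := by
  refine ⟨hH, fun f hf => ?_⟩
  by_contra! hlt
  refine hx (Finset.prod_eq_zero (Finset.mem_univ f) ?_)
  obtain ⟨i, hi⟩ := mem_cons_iff.1 hf
  refine moebiusSum_const_one ⟨i, mem_nbrIn.2 hi⟩ fun C hC => ?_
  have h1 := Finset.card_le_card hC
  rw [card_nbrIn] at h1
  exact I.marginalDensity_eq_one (harity f) (huniform f) (hC.trans (nbrIn_subset_nbr hH f))
    (by omega) x

/-- A pure product is orthogonal to the functions of the variables in `S` unless its subgraph is
`S`-closed. -/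
theorem sum_pureProd_mul_eq_zero [Nonempty Ω] (hτ : 0 < τ)
    (harity : ∀ f, τ - 1 ≤ (I.nbr f).card) (huniform : ∀ f, IsTWiseUniform (τ - 1) (I.μ f))
    {H : Finset (F × V)} (hH : H ⊆ I.edges) {S : Finset V} {g : (V → Ω) → ℝ}
    (hg : DependsOn g (S : Set V)) (hS : ¬ I.IsClosedSubgraph τ S H) :
    ∑ x, I.pureProd H x * g x = 0 := by
  by_cases hT : I.IsTauSubgraph τ H
  · simp only [IsClosedSubgraph, hT, true_and, not_forall] at hS
    obtain ⟨i, hi, hiS⟩ := hS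
    exact sum_mul_eq_zero_of_dependsOn (I.sum_pureProd_update hH hi) hg (by simpa using hiS)
  · refine Finset.sum_eq_zero fun x _ => ?_
    rw [mul_eq_zero]
    left
    by_contra hx
    exact hT (I.isTauSubgraph_of_pureProd_ne_zero hτ harity huniform hH hx)

/-! ### The signed density of the pseudoexpectation -/

open Classical in
/-- The sum of the pure products over all small `τ`-subgraphs. -/
def signedDensity (τ : ℕ) (SMALL : ℝ) (x : V → Ω) : ℝ :=
  ∑ H ∈ I.edges.powerset.filter fun H => I.IsTauSubgraph τ H ∧ IsSmall SMALL H, I.pureProd H x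

variable {SMALL : ℝ}

theorem subset_cl {S : Finset V} {H : Finset (F × V)} (hH : I.IsClosedSubgraph τ S H)
    (hs : IsSmall SMALL H) : H ⊆ I.cl τ SMALL S := by
  classical
  refine Finset.subset_biUnion_of_mem (id : Finset (F × V) → _) ?_
  exact Finset.mem_filter.2 ⟨Finset.mem_powerset.2 hH.1.1, hH, hs⟩

/-- Expand both sides into pure products. Against g only S-closed subgraphs survive, and the small
ones are exactly the S-closed subgraphs of G, since G is small and contains the closure. The freedom
to enlarge G beyond the closure makes the local densities compatible. -/
theorem sum_signedDensity_mul [Nonempty Ω] (hτ : 0 < τ)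
    (harity : ∀ f, τ - 1 ≤ (I.nbr f).card) (huniform : ∀ f, IsTWiseUniform (τ - 1) (I.μ f))
    {S : Finset V} {g : (V → Ω) → ℝ} (hg : DependsOn g (S : Set V))
    {G : Finset (F × V)} (hG : G ⊆ I.edges) (hsmall : IsSmall SMALL G)
    (hcl : I.cl τ SMALL S ⊆ G) :
    ∑ x, I.signedDensity τ SMALL x * g x = ∑ x, I.density G x * g x := by
  classical
  have hz : ∀ H ⊆ I.edges, ¬ I.IsClosedSubgraph τ S H → ∑ x, I.pureProd H x * g x = 0 :=
    fun H hH => I.sum_pureProd_mul_eq_zero hτ harity huniform hH hg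
  simp_rw [density_eq_sum_pureProd, signedDensity, Finset.sum_mul]
  rw [Finset.sum_comm, Finset.sum_comm (s := Finset.univ)]
  rw [← Finset.sum_filter_of_ne (p := fun H => I.IsClosedSubgraph τ S H),
    ← Finset.sum_filter_of_ne (s := G.powerset) (p := fun H => I.IsClosedSubgraph τ S H)]
  · refine Finset.sum_congr ?_ fun _ _ => rfl
    ext H
    simp only [Finset.mem_filter, Finset.mem_powerset]
    constructor
    · rintro ⟨⟨_, _, h3⟩, h4⟩
      exact ⟨(I.subset_cl h4 h3).trans hcl, h4⟩
    · rintro ⟨h1, h2⟩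
      exact ⟨⟨h1.trans hG, h2.1, hsmall.mono h1⟩, h2⟩
  · intro H hH hne
    by_contra h
    exact hne (hz H ((Finset.mem_powerset.1 hH).trans hG) h)
  · intro H hH hne
    by_contra h
    exact hne (hz H (Finset.mem_powerset.1 (Finset.mem_filter.1 hH).1) h)

end CSPInstance

end

noncomputable section

namespace CSPInstance

variable {V F Ω : Type*} [Fintype V] [DecidableEq V] [Fintype F] [DecidableEq F]
  [Fintype Ω] [DecidableEq Ω]

/-! ### Sizes of closures -/

/-- A count of variables, constraints and edges of `H`, relative to a set `S` of variables. -/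
def potential (τ : ℕ) (S : Finset V) (H : Finset (F × V)) : ℤ :=
  2 * (vbls H ∪ S).card + τ * (cons H).card - 2 * H.card

/-- Count edges by their variable end: each variable outside A has degree at least 2, or at least 1
if it lies in T, and each variable of G in A has degree at least 1. -/
theorem two_mul_card_sdiff_add_card_inter_le (G : Finset (F × V)) (A T : Finset V)
    (h : ∀ i ∉ A, i ∉ T → vblDegree G i ≠ 1) :
    2 * (vbls G \ A).card + (vbls G ∩ A).card ≤ G.card + (T \ A).card := by
  have h1 : ∑ i ∈ vbls G \ A, 2 ≤ ∑ i ∈ vbls G \ A, (vblDegree G i + if i ∈ T then 1 else 0) := by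
    refine Finset.sum_le_sum fun i hi => ?_
    obtain ⟨hi, hA⟩ := Finset.mem_sdiff.1 hi
    have h0 := vblDegree_pos.2 hi
    split_ifs with hT
    · omega
    · have := h i hA hT
      omega
  have h2 : ∑ i ∈ vbls G \ A, (if i ∈ T then 1 else 0) ≤ (T \ A).card := by
    rw [← Finset.card_filter]
    refine Finset.card_le_card fun i hi => ?_
    simp only [Finset.mem_filter, Finset.mem_sdiff] at hi ⊢
    exact ⟨hi.2, hi.1.2⟩
  have h3 : ∑ i ∈ vbls G ∩ A, 1 ≤ ∑ i ∈ vbls G ∩ A, vblDegree G i :=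
    Finset.sum_le_sum fun i hi => vblDegree_pos.2 (Finset.mem_inter.1 hi).1
  have h4 : G.card = ∑ i ∈ vbls G \ A, vblDegree G i + ∑ i ∈ vbls G ∩ A, vblDegree G i := by
    rw [card_eq_sum_vblDegree, ← Finset.sum_sdiff (Finset.sdiff_subset (s := vbls G) (t := A)),
      sdiff_sdiff_right_self, add_comm]
    rfl
  rw [Finset.sum_add_distrib] at h1
  simp only [Finset.sum_const, smul_eq_mul, mul_one] at h1 h3
  omega

variable {I : CSPInstance V F Ω} {τ : ℕ} {ζ SMALL : ℝ}

/-! ### Closed subgraphs under union, and the growth of the potential. -/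

theorem IsTauSubgraph.union {G H : Finset (F × V)} (hG : I.IsTauSubgraph τ G)
    (hH : I.IsTauSubgraph τ H) : I.IsTauSubgraph τ (G ∪ H) := by
  refine ⟨Finset.union_subset hG.1 hH.1, fun f hf => ?_⟩
  rw [cons_union, Finset.mem_union] at hf
  rcases hf with hf | hf
  · exact (hG.2 f hf).trans (consDegree_mono Finset.subset_union_left f)
  · exact (hH.2 f hf).trans (consDegree_mono Finset.subset_union_right f)

theorem isTauSubgraph_empty : I.IsTauSubgraph τ ∅ := by
  simp [IsTauSubgraph, cons]

theorem IsClosedSubgraph.union {S : Finset V} {G H : Finset (F × V)}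
    (hG : I.IsClosedSubgraph τ S G) (hH : I.IsClosedSubgraph τ S H) :
    I.IsClosedSubgraph τ S (G ∪ H) := by
  refine ⟨hG.1.union hH.1, fun i hi => ?_⟩
  have hv : i ∈ vbls (G ∪ H) := vblDegree_pos.1 (by omega)
  rw [vbls_union, Finset.mem_union] at hv
  rcases hv with hv | hv
  · have := vblDegree_mono (Finset.subset_union_left (s₁ := G) (s₂ := H)) i
    exact hG.2 i (by have := vblDegree_pos.2 hv; omega)
  · have := vblDegree_mono (Finset.subset_union_right (s₁ := G) (s₂ := H)) i
    exact hH.2 i (by have := vblDegree_pos.2 hv; omega)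

theorem isClosedSubgraph_of_vbls_subset {S : Finset V} {H : Finset (F × V)}
    (hH : I.IsTauSubgraph τ H) (h : vbls H ⊆ S) : I.IsClosedSubgraph τ S H :=
  ⟨hH, fun _ hi => h (vblDegree_pos.1 (by omega))⟩

/-- Each new edge costs 2. One unit pays for the new constraints, each having all of its at least τ
edges in X \ C; the other pays for the new variables by `two_mul_card_sdiff_add_card_inter_le`, with
the leaves in T as the only deficit. The intersection term is the surplus from edges landing on old
variables; it is what positivity needs. -/
theorem potential_add_card_le {S T : Finset V} {C X : Finset (F × V)} (hCX : C ⊆ X)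
    (hX : I.IsClosedSubgraph τ (vbls C ∪ S ∪ T) X) :
    potential τ S X + (vbls (X \ C) ∩ (vbls C ∪ S)).card ≤
      potential τ S C + (T \ (vbls C ∪ S)).card := by
  have h1 := two_mul_card_sdiff_add_card_inter_le (X \ C) (vbls C ∪ S) T fun i hA hT hdeg => by
    have h2 : vblDegree X i = vblDegree (X \ C) i := by
      unfold vblDegree
      congr 1
      ext ⟨f, j⟩
      simp only [Finset.mem_filter, Finset.mem_sdiff]
      constructor
      · rintro ⟨h, rfl⟩
        exact ⟨⟨h, fun hC => hA (Finset.mem_union_left _ (mem_vbls_iff.2 ⟨f, hC⟩))⟩, rfl⟩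
      · rintro ⟨⟨h, _⟩, rfl⟩
        exact ⟨h, rfl⟩
    have := hX.2 i (h2.trans hdeg)
    rw [Finset.mem_union] at this
    tauto
  have h2 : (vbls X ∪ S).card = (vbls C ∪ S).card + (vbls (X \ C) \ (vbls C ∪ S)).card := by
    rw [add_comm, Finset.card_sdiff_add_card]
    congr 1
    conv_lhs => rw [← Finset.sdiff_union_of_subset hCX, vbls_union, Finset.union_assoc]
  have h3 : (X \ C).card + C.card = X.card := Finset.card_sdiff_add_card_eq_card hCX
  have h4 : (cons X \ cons C).card + (cons C).card = (cons X).card :=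
    Finset.card_sdiff_add_card_eq_card (cons_mono hCX)
  have h5 : τ * (cons X \ cons C).card ≤ (X \ C).card := by
    rw [card_eq_sum_consDegree, mul_comm, ← smul_eq_mul, ← Finset.sum_const]
    calc ∑ f ∈ cons X \ cons C, τ ≤ ∑ f ∈ cons X \ cons C, consDegree (X \ C) f := by
          refine Finset.sum_le_sum fun f hf => ?_
          obtain ⟨hfX, hfC⟩ := Finset.mem_sdiff.1 hf
          refine (hX.1.2 f hfX).trans (Finset.card_le_card fun e he => ?_)
          obtain ⟨heX, rfl⟩ := Finset.mem_filter.1 he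
          refine Finset.mem_filter.2 ⟨Finset.mem_sdiff.2 ⟨heX, fun hC => hfC ?_⟩, rfl⟩
          exact mem_cons_iff.2 ⟨e.2, hC⟩
      _ ≤ ∑ f ∈ cons (X \ C), consDegree (X \ C) f := by
          refine Finset.sum_le_sum_of_subset fun f hf => ?_
          obtain ⟨hfX, hfC⟩ := Finset.mem_sdiff.1 hf
          obtain ⟨i, hi⟩ := mem_cons_iff.1 hfX
          exact mem_cons_iff.2 ⟨i, Finset.mem_sdiff.2 ⟨hi, fun hC => hfC (mem_cons_iff.2 ⟨i, hC⟩)⟩⟩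
  unfold potential
  rw [← h4, h2]
  push_cast
  zify at h1 h3 h5
  linarith

theorem Plausible.mul_card_cons_le (hp : I.Plausible τ ζ SMALL) (S : Finset V)
    {X : Finset (F × V)} (hX : I.IsTauSubgraph τ X) (hc : ((cons X).card : ℝ) ≤ 2 * SMALL) :
    ζ * (cons X).card ≤ potential τ S X := by
  have h1 := hp X hX hc
  have h2 : ((vbls X).card : ℝ) ≤ (vbls X ∪ S).card := by
    exact_mod_cast Finset.card_le_card Finset.subset_union_left
  unfold potential
  push_cast
  linarith

theorem potential_empty (S : Finset V) :
    potential τ S (∅ : Finset (F × V)) = 2 * S.card := by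
  simp [potential, vbls, cons]

/-- Two small closed subgraphs, one of them above `C`, have a small union. -/
theorem Plausible.isSmall_union (hp : I.Plausible τ ζ SMALL) (hζ : 0 < ζ) {S T : Finset V}
    {C X Y : Finset (F × V)} (hbound : (potential τ S C : ℝ) + T.card ≤ ζ * SMALL)
    (hCX : C ⊆ X) (hX : I.IsClosedSubgraph τ (vbls C ∪ S ∪ T) X) (hXs : IsSmall SMALL X)
    (hY : I.IsClosedSubgraph τ (vbls C ∪ S ∪ T) Y) (hYs : IsSmall SMALL Y) :
    IsSmall SMALL (X ∪ Y) := by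
  have hXY := hX.union hY
  have h1 := potential_add_card_le (hCX.trans Finset.subset_union_left) hXY
  -- This is why plausibility is assumed up to twice `SMALL`: it applies to the union before the
  -- union is known to be small.
  have h2 : ((cons (X ∪ Y)).card : ℝ) ≤ 2 * SMALL := by
    unfold IsSmall at hXs hYs
    have : ((cons (X ∪ Y)).card : ℝ) ≤ (cons X).card + (cons Y).card := by
      rw [cons_union]
      exact_mod_cast Finset.card_union_le _ _
    linarith
  have h3 := hp.mul_card_cons_le S hXY.1 h2
  have h4 : (potential τ S (X ∪ Y) : ℝ) ≤ potential τ S C + T.card := by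
    have h5 : (T \ (vbls C ∪ S)).card ≤ T.card := Finset.card_le_card Finset.sdiff_subset
    have : potential τ S (X ∪ Y) ≤ potential τ S C + T.card := by
      zify at h5
      linarith [Int.natCast_nonneg (vbls ((X ∪ Y) \ C) ∩ (vbls C ∪ S)).card]
    exact_mod_cast this
  exact le_of_mul_le_mul_left (h3.trans (h4.trans hbound)) hζ

/-- Starting from C, adjoin the small closed subgraphs one at a time; the potential bound brings the
size back below `SMALL` after each step. -/
theorem Plausible.isSmall_cl (hp : I.Plausible τ ζ SMALL) (hζ : 0 < ζ) {S T : Finset V}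
    {C : Finset (F × V)} (hC : I.IsTauSubgraph τ C) (hCs : IsSmall SMALL C)
    (hbound : (potential τ S C : ℝ) + T.card ≤ ζ * SMALL) :
    IsSmall SMALL (I.cl τ SMALL (vbls C ∪ S ∪ T)) := by
  classical
  have key : ∀ 𝓑 : Finset (Finset (F × V)),
      (∀ Y ∈ 𝓑, I.IsClosedSubgraph τ (vbls C ∪ S ∪ T) Y ∧ IsSmall SMALL Y) →
      I.IsClosedSubgraph τ (vbls C ∪ S ∪ T) (C ∪ 𝓑.biUnion id) ∧
        IsSmall SMALL (C ∪ 𝓑.biUnion id) := by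
    intro 𝓑
    induction 𝓑 using Finset.induction_on with
    | empty =>
      intro _
      simp only [Finset.biUnion_empty, Finset.union_empty]
      exact ⟨isClosedSubgraph_of_vbls_subset hC
        (Finset.subset_union_left.trans Finset.subset_union_left), hCs⟩
    | insert Y 𝓑 hY ih =>
      intro h
      obtain ⟨h1, h2⟩ := ih fun Z hZ => h Z (Finset.mem_insert_of_mem hZ)
      obtain ⟨h3, h4⟩ := h Y (Finset.mem_insert_self _ _)
      have : C ∪ (insert Y 𝓑).biUnion id = (C ∪ 𝓑.biUnion id) ∪ Y := by
        rw [Finset.biUnion_insert, id, Finset.union_comm Y, Finset.union_assoc]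
      rw [this]
      exact ⟨h1.union h3, hp.isSmall_union hζ hbound Finset.subset_union_left h1 h2 h3 h4⟩
  refine (key (I.edges.powerset.filter fun H =>
    I.IsClosedSubgraph τ (vbls C ∪ S ∪ T) H ∧ IsSmall SMALL H) ?_).2.mono ?_
  · intro Y hY
    exact (Finset.mem_filter.1 hY).2
  · exact Finset.subset_union_right

theorem cl_subset_edges (S : Finset V) : I.cl τ SMALL S ⊆ I.edges := by
  classical
  refine Finset.biUnion_subset.2 fun H hH => ?_
  exact Finset.mem_powerset.1 (Finset.mem_filter.1 hH).1

theorem Plausible.isSmall_cl_of_card_le (hp : I.Plausible τ ζ SMALL) (hζ : 0 < ζ)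
    (hS : 0 ≤ SMALL) {T : Finset V} (hT : (T.card : ℝ) ≤ ζ * SMALL) :
    IsSmall SMALL (I.cl τ SMALL T) := by
  -- The whole set is put in the role of T, where a variable costs 1, and not in that of S, where it
  -- costs 2.
  have h := hp.isSmall_cl hζ (S := ∅) (T := T) (C := ∅) isTauSubgraph_empty
    (by simpa [IsSmall, cons] using hS) (by simpa [potential_empty] using hT)
  have h0 : vbls (∅ : Finset (F × V)) ∪ ∅ ∪ T = T := by simp [vbls]
  rwa [h0] at h

theorem Plausible.eq_empty (hp : I.Plausible τ ζ SMALL) (hζ : 0 < ζ) (hS : 0 ≤ SMALL)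
    {H : Finset (F × V)} (hH : I.IsClosedSubgraph τ ∅ H) (hs : IsSmall SMALL H) : H = ∅ := by
  have h1 := potential_add_card_le (S := ∅) (T := ∅) (C := ∅) (X := H) (Finset.empty_subset _)
    (by simpa [vbls] using hH)
  rw [potential_empty] at h1
  simp only [Finset.card_empty, Finset.empty_sdiff] at h1
  have h2 := hp.mul_card_cons_le ∅ hH.1 (by unfold IsSmall at hs; linarith)
  have h3 : (potential τ ∅ H : ℝ) ≤ 0 := by
    have : potential τ ∅ H ≤ 0 := by push_cast at h1; omega
    exact_mod_cast this
  have h4 : ((cons H).card : ℝ) ≤ 0 := by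
    by_contra! h
    have := mul_pos hζ h
    linarith
  have h5 : (cons H).card = 0 := by exact_mod_cast le_antisymm h4 (Nat.cast_nonneg _)
  simpa [cons] using h5

/-- A small `τ`-subgraph minimizing the potential, and maximal among these. -/
theorem exists_maximal_minimizer (hS : 0 ≤ SMALL) (S : Finset V) :
    ∃ C : Finset (F × V), I.IsTauSubgraph τ C ∧ IsSmall SMALL C ∧
      potential τ S C ≤ 2 * S.card ∧
      (∀ e ∈ I.edges, e.1 ∈ cons C → e ∈ C) ∧
      ∀ X, I.IsTauSubgraph τ X → IsSmall SMALL X → C ⊂ X → potential τ S C < potential τ S X := by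
  classical
  set 𝓒 := I.edges.powerset.filter fun H => I.IsTauSubgraph τ H ∧ IsSmall SMALL H with h𝓒
  have hmem : ∀ H, H ∈ 𝓒 ↔ I.IsTauSubgraph τ H ∧ IsSmall SMALL H := fun H => by
    simp only [h𝓒, Finset.mem_filter, Finset.mem_powerset, and_iff_right_iff_imp]
    exact fun h => h.1.1
  have h0 : ∅ ∈ 𝓒 := (hmem _).2 ⟨isTauSubgraph_empty, by simpa [IsSmall, cons] using hS⟩
  -- Lexicographic minimum: least potential first, then most edges.
  obtain ⟨C, hC, hmin⟩ := Finset.exists_min_image 𝓒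
    (fun H => toLex (potential τ S H, -(H.card : ℤ))) ⟨∅, h0⟩
  simp only [Prod.Lex.toLex_le_toLex] at hmin
  obtain ⟨hCτ, hCs⟩ := (hmem C).1 hC
  have hlt : ∀ X, I.IsTauSubgraph τ X → IsSmall SMALL X → C ⊂ X →
      potential τ S C < potential τ S X := by
    intro X hX hXs hCX
    have hcard := Finset.card_lt_card hCX
    rcases hmin X ((hmem X).2 ⟨hX, hXs⟩) with h | ⟨_, h⟩
    · exact h
    · omega
  refine ⟨C, hCτ, hCs, ?_, fun e he heC => ?_, hlt⟩
  · have := hmin ∅ h0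
    rw [potential_empty] at this
    rcases this with h | ⟨h, _⟩
    · exact h.le
    · exact h.le
  · by_contra hne
    have hcons : cons (insert e C) = cons C := by
      rw [cons, Finset.image_insert]
      exact Finset.insert_eq_of_mem heC
    have hτ : I.IsTauSubgraph τ (insert e C) :=
      ⟨Finset.insert_subset he hCτ.1, fun f hf => (hCτ.2 f (hcons ▸ hf)).trans
        (consDegree_mono (Finset.subset_insert _ _) f)⟩
    have h := hlt _ hτ (by unfold IsSmall at *; rwa [hcons]) (Finset.ssubset_insert hne)
    -- An edge at a constraint already in C adds at most one variable, worth 2, and costs 2. The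
    -- potential does not rise, contradicting the choice of C.
    have h2 : (vbls (insert e C) ∪ S).card ≤ (vbls C ∪ S).card + 1 := by
      rw [vbls, Finset.image_insert, Finset.insert_union]
      exact Finset.card_insert_le _ _
    unfold potential at h
    rw [hcons, Finset.card_insert_of_notMem hne] at h
    push_cast at h
    omega

end CSPInstance

end

namespace CSPInstance

variable {V F Ω : Type*} [Fintype V] [DecidableEq V] [Fintype F] [DecidableEq F]
  [Fintype Ω] [DecidableEq Ω] {I : CSPInstance V F Ω} {τ : ℕ} {ζ SMALL : ℝ}

/-! ### Positivity of the signed density -/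

/-- Saturation of C means that no constraint has edges both in C and in H \ C, so no marginal
density has to be split. -/
theorem density_eq_mul_density_sdiff {C H : Finset (F × V)} (hCH : C ⊆ H) (hH : H ⊆ I.edges)
    (hsat : ∀ e ∈ I.edges, e.1 ∈ cons C → e ∈ C) (x : V → Ω) :
    I.density H x = I.density C x * I.density (H \ C) x := by
  unfold density
  rw [← Finset.prod_mul_distrib]
  refine Finset.prod_congr rfl fun f _ => ?_
  by_cases hf : f ∈ cons C
  · have h1 : nbrIn (H \ C) f = ∅ := by
      ext i
      simp only [mem_nbrIn, Finset.mem_sdiff, Finset.notMem_empty, iff_false, not_and, not_not]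
      exact fun h => hsat _ (hH h) hf
    have h2 : nbrIn H f = nbrIn C f := by
      ext i
      simp only [mem_nbrIn]
      exact ⟨fun h => hsat _ (hH h) hf, fun h => hCH h⟩
    rw [h1, h2, marginalDensity_empty, mul_one]
  · have h2 : nbrIn H f = nbrIn (H \ C) f := by
      ext i
      simp only [mem_nbrIn, Finset.mem_sdiff, iff_self_and]
      exact fun _ hC => hf (mem_cons_iff.2 ⟨i, hC⟩)
    rw [nbrIn_eq_empty hf, h2, marginalDensity_empty, one_mul]

/-- A function of the variables of a maximal minimizer `C` that is orthogonal to the functions of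
the smaller sets of variables of `C`, and to the functions of `T` if `T` lies in `C`, is
orthogonal to all functions of `T`. -/
theorem sum_signedDensity_mul_eq_zero [Nonempty Ω] (hτ : 0 < τ)
    (harity : ∀ f, τ - 1 ≤ (I.nbr f).card) (huniform : ∀ f, IsTWiseUniform (τ - 1) (I.μ f))
    (hp : I.Plausible τ ζ SMALL) (hζ : 0 < ζ) {S T : Finset V} {C : Finset (F × V)}
    (hC : I.IsTauSubgraph τ C) (hCs : IsSmall SMALL C)
    (hbound : (potential τ S C : ℝ) + T.card ≤ ζ * SMALL)
    (hsat : ∀ e ∈ I.edges, e.1 ∈ cons C → e ∈ C)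
    (hmax : ∀ X, I.IsTauSubgraph τ X → IsSmall SMALL X → C ⊂ X →
      potential τ S C < potential τ S X)
    {r t : (V → Ω) → ℝ} (hr : DependsOn r (vbls C ∪ S : Finset V))
    (ht : DependsOn t (T : Set V))
    (horth : ∀ U ⊆ vbls C ∪ S, (U.card < T.card ∨ U = T) → ∀ k : (V → Ω) → ℝ,
      DependsOn k (U : Set V) → ∑ x, I.density C x * (r x * k x) = 0) :
    ∑ x, I.signedDensity τ SMALL x * (r x * t x) = 0 := by
  set A := vbls C ∪ S with hA
  set H := I.cl τ SMALL (A ∪ T) with hH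
  have hHs : IsSmall SMALL H := hp.isSmall_cl hζ hC hCs hbound
  have hHe : H ⊆ I.edges := cl_subset_edges _
  have hCA : vbls C ⊆ A := Finset.subset_union_left
  have hCH : C ⊆ H := I.subset_cl (isClosedSubgraph_of_vbls_subset hC
    (hCA.trans Finset.subset_union_left)) hCs
  have hrt : DependsOn (fun x => r x * t x) (A ∪ T : Finset V) := fun x y h => by
    simp only
    rw [hr fun i hi => h i (by simpa using Or.inl hi),
      ht fun i hi => h i (by simpa using Or.inr hi)]
  rw [I.sum_signedDensity_mul hτ harity huniform hrt hHe hHs subset_rfl]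
  -- Only the part outside C is expanded; `density C` is kept whole, as the weight for which r is a
  -- residual.
  have hexp : ∀ x, I.density H x * (r x * t x) =
      ∑ G ∈ (H \ C).powerset, I.pureProd G x * (I.density C x * (r x * t x)) := fun x => by
    rw [density_eq_mul_density_sdiff hCH hHe hsat, I.density_eq_sum_pureProd (H \ C),
      ← Finset.sum_mul]
    ring
  simp_rw [hexp]
  rw [Finset.sum_comm]
  refine Finset.sum_eq_zero fun G hG => ?_
  rw [Finset.mem_powerset] at hG
  have hGH : G ⊆ H := hG.trans Finset.sdiff_subset
  have hdep : DependsOn (fun x => I.density C x * (r x * t x)) (A ∪ T : Finset V) :=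
    fun x y h => by
      simp only
      rw [show r x * t x = r y * t y from hrt h, I.dependsOn_density C fun i hi =>
        h i (Finset.mem_coe.2 (Finset.mem_union_left _ (hCA (Finset.mem_coe.1 hi))))]
  by_cases hcl : I.IsClosedSubgraph τ (A ∪ T) G
  swap
  · exact I.sum_pureProd_mul_eq_zero hτ harity huniform (hGH.trans hHe) hdep hcl
  have hb : DependsOn (fun x => t x * I.pureProd G x) (T ∪ vbls G : Finset V) := fun x y h => by
    simp only
    rw [ht fun i hi => h i (by simpa using Or.inl hi),
      I.dependsOn_pureProd G fun i hi => h i (by simpa using Or.inr hi)]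
  -- The other factors depend on A alone, so t times the pure product may be replaced by its average
  -- over the coordinates outside A.
  obtain ⟨k, hk, hk2⟩ := exists_conditional_expectation A hb
  have ha : DependsOn (fun x => I.density C x * r x) (A : Set V) := fun x y h => by
    simp only
    rw [hr h, I.dependsOn_density C fun i hi => h i (hCA hi)]
  have h1 : ∑ x, I.pureProd G x * (I.density C x * (r x * t x)) =
      ∑ x, I.density C x * (r x * k x) := by
    rw [Finset.sum_congr rfl fun x _ => show I.pureProd G x * (I.density C x * (r x * t x)) =
      I.density C x * r x * (t x * I.pureProd G x) by ring, hk2 _ ha]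
    exact Finset.sum_congr rfl fun x _ => by ring
  rw [h1]
  refine horth (A ∩ (T ∪ vbls G)) Finset.inter_subset_left ?_ k (by
    rw [Finset.coe_inter]; exact hk)
  rcases Finset.eq_empty_or_nonempty G with rfl | hne
  · have : vbls (∅ : Finset (F × V)) = ∅ := rfl
    rw [this, Finset.union_empty]
    rcases (Finset.inter_subset_right (s₁ := A) (s₂ := T)).eq_or_ssubset with h | h
    · exact Or.inr h
    · exact Or.inl (Finset.card_lt_card h)
  · left
    have hdisj : Disjoint C G := Finset.disjoint_of_subset_right hG Finset.disjoint_sdiff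
    have hss : C ⊂ C ∪ G := by
      refine Finset.ssubset_iff_subset_ne.2 ⟨Finset.subset_union_left, fun h => ?_⟩
      obtain ⟨e, he⟩ := hne
      exact Finset.disjoint_left.1 hdisj (h ▸ Finset.mem_union_right _ he) he
    have hCGH : C ∪ G ⊆ H := Finset.union_subset hCH hGH
    -- The potential strictly rises, yet it grows by at most |T \ A| - |vbls G ∩ A|. Hence |vbls G ∩
    -- A| < |T \ A|, and k depends on fewer than |T| variables.
    have h2 := hmax (C ∪ G) (hC.union hcl.1) (hHs.mono hCGH) hss
    have hCcl : I.IsClosedSubgraph τ (A ∪ T) C :=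
      isClosedSubgraph_of_vbls_subset hC (hCA.trans Finset.subset_union_left)
    have h3 := potential_add_card_le (S := S) (T := T) Finset.subset_union_left
      (hCcl.union hcl)
    rw [Finset.union_sdiff_cancel_left hdisj, ← hA] at h3
    have h4 : (A ∩ (T ∪ vbls G)).card ≤ (T ∩ A).card + (vbls G ∩ A).card := by
      rw [Finset.inter_comm, Finset.union_inter_distrib_right]
      exact Finset.card_union_le _ _
    have h5 := Finset.card_inter_add_card_sdiff T A
    omega

theorem sum_signedDensity_sq_nonneg [Nonempty Ω] (hτ : 0 < τ)
    (harity : ∀ f, τ - 1 ≤ (I.nbr f).card) (huniform : ∀ f, IsTWiseUniform (τ - 1) (I.μ f))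
    (hp : I.Plausible τ ζ SMALL) (hζ : 0 < ζ) (hS : 0 ≤ SMALL) (𝓛 : Finset (Finset V))
    (hcard : ∀ S ∈ 𝓛, (3 * S.card : ℝ) ≤ ζ * SMALL)
    (hdown : ∀ S ∈ 𝓛, ∀ T : Finset V, T.card < S.card → T ∈ 𝓛)
    {f : (V → Ω) → ℝ} (hf : f ∈ 𝓛.sup (localFunctions Ω)) :
    0 ≤ ∑ x, I.signedDensity τ SMALL x * f x ^ 2 := by
  classical
  induction hn : 𝓛.card generalizing 𝓛 f with
  | zero =>
    rw [Finset.card_eq_zero.1 hn, Finset.sup_empty, Submodule.mem_bot] at hf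
    simp [hf]
  | succ n ih =>
    obtain ⟨S, hSL, hSmax⟩ := Finset.exists_max_image 𝓛 Finset.card
      (Finset.card_pos.1 (by omega))
    set 𝓛' := 𝓛.erase S with h𝓛'
    have hmem : ∀ T ∈ 𝓛', ∀ U : Finset V, (U.card < T.card ∨ U = T) → U ∈ 𝓛' := by
      intro T hT U hU
      rcases hU with hU | rfl
      · have hTL := Finset.mem_of_mem_erase hT
        have := hSmax T hTL
        exact Finset.mem_erase.2 ⟨fun h => by subst h; omega, hdown T hTL U hU⟩
      · exact hT
    obtain ⟨C, hC, hCs, hCpot, hsat, hmax⟩ := exists_maximal_minimizer (I := I) (τ := τ) hS S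
    have hCpot' : (potential τ S C : ℝ) ≤ 2 * S.card := by exact_mod_cast hCpot
    rw [← Finset.insert_erase hSL, Finset.sup_insert, Submodule.mem_sup] at hf
    obtain ⟨g, hg, p, hpp, rfl⟩ := hf
    set W : Submodule ℝ ((V → Ω) → ℝ) :=
      (𝓛'.filter fun U => U ⊆ vbls C ∪ S).sup (localFunctions Ω) with hW
    -- Projecting within functions of vbls C ∪ S keeps the residual local there, so that its square
    -- is integrated against a genuine density.
    obtain ⟨h, hh, horth⟩ := exists_weighted_projection W (I.density C) (I.density_nonneg C) g
    have hW1 : W ≤ 𝓛'.sup (localFunctions Ω) := Finset.sup_mono (Finset.filter_subset _ _)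
    have hW2 : W ≤ localFunctions Ω (vbls C ∪ S) := Finset.sup_le fun U hU =>
      fun k hk x y hxy => hk fun i hi => hxy i ((Finset.mem_filter.1 hU).2 hi)
    have hr : DependsOn (fun x => g x - h x) (vbls C ∪ S : Finset V) := fun x y hxy => by
      simp only
      rw [hW2 hh hxy, hg fun i hi => hxy i (Finset.mem_coe.2 (Finset.mem_union_right _ hi))]
    let B : ((V → Ω) → ℝ) →ₗ[ℝ] ℝ :=
      ∑ x, (I.signedDensity τ SMALL x * (g x - h x)) • LinearMap.proj x
    have hB : ∀ t, B t = ∑ x, I.signedDensity τ SMALL x * ((g x - h x) * t x) := fun t => by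
      simp only [B, LinearMap.sum_apply, LinearMap.smul_apply, LinearMap.proj_apply, smul_eq_mul,
        mul_assoc]
    have hker : 𝓛'.sup (localFunctions Ω) ≤ LinearMap.ker B := by
      refine Finset.sup_le fun T hT t ht => ?_
      have hTL := Finset.mem_of_mem_erase hT
      rw [LinearMap.mem_ker, hB]
      refine sum_signedDensity_mul_eq_zero hτ harity huniform hp hζ hC hCs ?_ hsat hmax hr ht ?_
      -- Source of the factor 1/3: the potential of C is at most 2|S|, and T adds at most |S|.
      · have h1 := hcard S hSL
        have h2 : (T.card : ℝ) ≤ S.card := by exact_mod_cast hSmax T hTL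
        linarith
      · intro U hU hUT k hk
        refine horth k ?_
        have hU' : U ∈ 𝓛'.filter fun U => U ⊆ vbls C ∪ S :=
          Finset.mem_filter.2 ⟨hmem T hT U hUT, hU⟩
        exact Finset.le_sup (f := localFunctions Ω) hU' hk
    have hcross : ∑ x, I.signedDensity τ SMALL x * ((g x - h x) * (p + h) x) = 0 := by
      rw [← hB]
      exact hker (Submodule.add_mem _ hpp (hW1 hh))
    have hsq : 0 ≤ ∑ x, I.signedDensity τ SMALL x * (g x - h x) ^ 2 := by
      have hsm := hp.isSmall_cl hζ (S := S) (T := ∅) hC hCs (by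
        have := hcard S hSL
        have h0 : (0 : ℝ) ≤ S.card := Nat.cast_nonneg _
        simp only [Finset.card_empty, Nat.cast_zero]
        linarith)
      rw [Finset.union_empty] at hsm
      rw [I.sum_signedDensity_mul hτ harity huniform (S := vbls C ∪ S)
        (fun x y hxy => by simp only [hr hxy]) (cl_subset_edges _) hsm subset_rfl]
      exact Finset.sum_nonneg fun x _ => mul_nonneg (I.density_nonneg _ x) (sq_nonneg _)
    have hrest := ih 𝓛' (fun T hT => hcard T (Finset.mem_of_mem_erase hT))
      (fun T hT U hU => hmem T hT U (Or.inl hU)) (Submodule.add_mem _ hpp (hW1 hh))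
      (by rw [h𝓛', Finset.card_erase_of_mem hSL]; omega)
    have : ∑ x, I.signedDensity τ SMALL x * (g + p) x ^ 2 =
        ∑ x, I.signedDensity τ SMALL x * (g x - h x) ^ 2 +
        2 * ∑ x, I.signedDensity τ SMALL x * ((g x - h x) * (p + h) x) +
        ∑ x, I.signedDensity τ SMALL x * (p + h) x ^ 2 := by
      rw [Finset.mul_sum, ← Finset.sum_add_distrib, ← Finset.sum_add_distrib]
      refine Finset.sum_congr rfl fun x _ => ?_
      simp only [Pi.add_apply]
      ring
    rw [this, hcross]
    linarith

end CSPInstance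

/-! ### Polynomials as functions of the assignment -/

section PolynomialValues

variable {V Ω : Type*} [DecidableEq V] [DecidableEq Ω]

theorem dependsOn_eval_monomial (M : (V × Ω) →₀ ℕ) (a : ℝ) :
    DependsOn (fun x => MvPolynomial.eval (indicatorPoint x) (MvPolynomial.monomial M a))
      (monomialVbls M : Set V) := by
  intro x y h
  simp only [MvPolynomial.eval_monomial]
  congr 1
  refine Finset.prod_congr rfl fun e he => ?_
  have : x e.1 = y e.1 := h e.1 (by
    simp only [monomialVbls, Finset.coe_image]
    exact ⟨e, he, rfl⟩)
  simp [indicatorPoint, this]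

theorem card_monomialVbls_le_mlinDegree {p : MvPolynomial (V × Ω) ℝ} {M : (V × Ω) →₀ ℕ}
    (hM : M ∈ p.support) : (monomialVbls M).card ≤ mlinDegree p :=
  Finset.le_sup (f := fun M => (monomialVbls M).card) hM

theorem card_monomialVbls_le_totalDegree {p : MvPolynomial (V × Ω) ℝ} {M : (V × Ω) →₀ ℕ}
    (hM : M ∈ p.support) : (monomialVbls M).card ≤ p.totalDegree := by
  refine le_trans ?_ (MvPolynomial.le_totalDegree hM)
  refine Finset.card_image_le.trans ?_
  rw [Finset.card_eq_sum_ones]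
  exact Finset.sum_le_sum fun e he => Nat.one_le_iff_ne_zero.2 (Finsupp.mem_support_iff.1 he)

theorem mlinDegree_le_totalDegree (p : MvPolynomial (V × Ω) ℝ) :
    mlinDegree p ≤ p.totalDegree :=
  Finset.sup_le fun _ hM => card_monomialVbls_le_totalDegree hM

theorem mlinDegree_monomial_le (M : (V × Ω) →₀ ℕ) (a : ℝ) :
    mlinDegree (MvPolynomial.monomial M a) ≤ (monomialVbls M).card := by
  refine Finset.sup_le fun N hN => ?_
  rw [Finset.mem_singleton.1 (MvPolynomial.support_monomial_subset hN)]

theorem multilin_monomial (M : (V × Ω) →₀ ℕ) :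
    multilin (MvPolynomial.monomial M (1 : ℝ)) =
      MvPolynomial.monomial (∑ e ∈ M.support, Finsupp.single e 1) 1 := by
  have h : (MvPolynomial.basisMonomials (V × Ω) ℝ) M = MvPolynomial.monomial M 1 := by simp
  rw [multilin, ← h, Module.Basis.constr_basis, MvPolynomial.monomial_sum_one]
  rfl

theorem monomialVbls_sum_single_subset (M : (V × Ω) →₀ ℕ) :
    monomialVbls (∑ e ∈ M.support, Finsupp.single e 1) ⊆ monomialVbls M := by
  refine Finset.image_subset_image fun e he => ?_
  obtain ⟨e', he', h⟩ := Finset.mem_biUnion.1 (Finsupp.support_finsetSum he)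
  rw [Finset.mem_singleton.1 (Finsupp.support_single_subset h)]
  exact he'

theorem eval_multilin_monomial (M : (V × Ω) →₀ ℕ) (x : V → Ω) :
    MvPolynomial.eval (indicatorPoint x) (multilin (MvPolynomial.monomial M (1 : ℝ))) =
      MvPolynomial.eval (indicatorPoint x) (MvPolynomial.monomial M (1 : ℝ)) := by
  rw [multilin_monomial, MvPolynomial.monomial_sum_one, map_prod, MvPolynomial.eval_monomial,
    one_mul, Finsupp.prod]
  refine Finset.prod_congr rfl fun e he => ?_
  have := Finsupp.mem_support_iff.1 he
  simp only [MvPolynomial.eval_monomial, one_mul, Finsupp.prod_single_index, pow_zero, pow_one]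
  unfold indicatorPoint
  split_ifs <;> simp [this]

theorem sum_coeff_smul_monomial (p : MvPolynomial (V × Ω) ℝ) :
    p = ∑ M ∈ p.support, p.coeff M • MvPolynomial.monomial M (1 : ℝ) := by
  conv_lhs => rw [p.as_sum]
  exact Finset.sum_congr rfl fun M _ => by rw [MvPolynomial.smul_monomial, smul_eq_mul, mul_one]

theorem eval_mem_sup_localFunctions [Fintype V] (p : MvPolynomial (V × Ω) ℝ)
    (𝓛 : Finset (Finset V)) (h : ∀ M ∈ p.support, monomialVbls M ∈ 𝓛) :
    (fun x => MvPolynomial.eval (indicatorPoint x) p) ∈ 𝓛.sup (localFunctions Ω) := by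
  have : (fun x : V → Ω => MvPolynomial.eval (indicatorPoint x) p) =
      ∑ M ∈ p.support, fun x => MvPolynomial.eval (indicatorPoint x)
        (MvPolynomial.monomial M (p.coeff M)) := by
    funext x
    rw [Finset.sum_apply, ← map_sum, ← p.as_sum]
  rw [this]
  refine Submodule.sum_mem _ fun M hM => ?_
  exact Finset.le_sup (f := localFunctions Ω) (h M hM) (dependsOn_eval_monomial M _)

end PolynomialValues

namespace CSPInstance

variable {V F Ω : Type*} [Fintype V] [DecidableEq V] [Fintype F] [DecidableEq F]
  [Fintype Ω] [DecidableEq Ω] {I : CSPInstance V F Ω} {τ : ℕ} {ζ SMALL : ℝ}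

/-! ### The planted distributions -/

theorem agreeProb_eq_prod (H : Finset (F × V)) (x : V → Ω) :
    I.agreeProb H x = ∏ f, I.marginalProb f (nbrIn H f) x := by
  classical
  unfold agreeProb marginalProb suggestionProb
  rw [Finset.prod_univ_sum, Fintype.piFinset_univ]
  refine Finset.sum_congr rfl fun w _ => ?_
  by_cases h : I.Agrees H w x
  · rw [if_pos h]
    exact Finset.prod_congr rfl fun f _ => (if_pos fun i hi => h f i (mem_nbrIn.1 hi)).symm
  · rw [if_neg h]
    simp only [Agrees, not_forall] at h
    obtain ⟨f, i, hi, hne⟩ := h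
    exact (Finset.prod_eq_zero (Finset.mem_univ f)
      (if_neg fun h => hne (h i (mem_nbrIn.2 hi)))).symm

theorem density_eq_mul_agreeProb (H : Finset (F × V)) (x : V → Ω) :
    I.density H x = (Fintype.card Ω : ℝ) ^ H.card * I.agreeProb H x := by
  unfold density marginalDensity
  rw [Finset.prod_mul_distrib, agreeProb_eq_prod, Finset.prod_pow_eq_pow_sum]
  congr 2
  rw [card_eq_sum_consDegree]
  symm
  refine (Finset.sum_congr rfl fun f _ => (card_nbrIn H f).symm).trans
    (Finset.sum_subset (Finset.subset_univ _) fun f _ hf => ?_)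
  rw [nbrIn_eq_empty hf, Finset.card_empty]

/-- Each consistent family of suggestions fixes x on the variables of H and leaves the others free;
an inconsistent one agrees with no x. -/
theorem sum_agreeProb [Nonempty Ω] {H : Finset (F × V)} (hH : H ⊆ I.edges) :
    ∑ x, I.agreeProb H x =
      I.consistentProb H * (Fintype.card Ω : ℝ) ^ (Fintype.card V - (vbls H).card) := by
  classical
  unfold agreeProb consistentProb
  rw [Finset.sum_comm, Finset.sum_mul]
  refine Finset.sum_congr rfl fun w _ => ?_
  split_ifs with hw
  · have hex : ∀ i : V, ∃ c : Ω, ∀ (f : F) (j : I.nbr f), (f, (j : V)) ∈ H → (j : V) = i →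
        w f j = c := by
      intro i
      by_cases h : ∃ (f : F) (j : I.nbr f), (f, (j : V)) ∈ H ∧ (j : V) = i
      · obtain ⟨f, j, hj, rfl⟩ := h
        exact ⟨w f j, fun g k hk hkj => hw g k f j hk hj hkj⟩
      · push Not at h
        exact ⟨Classical.arbitrary Ω, fun f j hj hji => absurd hji (h f j hj)⟩
    choose y hy using hex
    have hiff : ∀ x, I.Agrees H w x ↔
        x ∈ Fintype.piFinset fun i => if i ∈ vbls H then {y i} else Finset.univ := by
      intro x
      rw [Fintype.mem_piFinset]
      constructor
      · intro h i
        split_ifs with hi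
        · obtain ⟨f, hf⟩ := mem_vbls_iff.1 hi
          have hn : i ∈ I.nbr f := mem_edges.1 (hH hf)
          rw [Finset.mem_singleton, ← h f ⟨i, hn⟩ hf, ← hy i f ⟨i, hn⟩ hf rfl]
        · exact Finset.mem_univ _
      · intro h f j hj
        have := h j
        rw [if_pos (mem_vbls_iff.2 ⟨f, hj⟩), Finset.mem_singleton] at this
        rw [this, hy j f j hj rfl]
    simp_rw [hiff]
    rw [← Finset.sum_filter, Finset.filter_univ_mem, Finset.sum_const, Fintype.card_piFinset,
      nsmul_eq_mul, mul_comm]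
    congr 1
    have : ∀ i, (if i ∈ vbls H then {y i} else (Finset.univ : Finset Ω)).card =
        if i ∈ vbls H then 1 else Fintype.card Ω := fun i => by
      split_ifs <;> simp
    simp_rw [this]
    rw [Finset.prod_ite, Finset.prod_const_one, one_mul, Finset.prod_const, Nat.cast_pow]
    congr 1
    rw [Finset.filter_not, Finset.filter_univ_mem, ← Finset.compl_eq_univ_sdiff,
      Finset.card_compl]
  · rw [zero_mul]
    refine Finset.sum_eq_zero fun x _ => if_neg fun h => hw fun f i g j hf hg hij => ?_
    rw [h f i hf, h g j hg, hij]

/-- Against the constant 1 only ∅-closed subgraphs contribute, and by `Plausible.eq_empty` the only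
small one is empty. -/
theorem sum_density [Nonempty Ω] (hτ : 0 < τ)
    (harity : ∀ f, τ - 1 ≤ (I.nbr f).card) (huniform : ∀ f, IsTWiseUniform (τ - 1) (I.μ f))
    (hp : I.Plausible τ ζ SMALL) (hζ : 0 < ζ) (hS : 0 ≤ SMALL)
    {H : Finset (F × V)} (hH : H ⊆ I.edges) (hs : IsSmall SMALL H) :
    ∑ x, I.density H x = (Fintype.card Ω : ℝ) ^ Fintype.card V := by
  simp_rw [density_eq_sum_pureProd]
  rw [Finset.sum_comm, Finset.sum_eq_single_of_mem ∅ (by simp)]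
  · simp [pureProd_empty]
  · intro G hG hne
    rw [Finset.mem_powerset] at hG
    have h := I.sum_pureProd_mul_eq_zero hτ harity huniform (hG.trans hH) (S := ∅)
      (g := fun _ => 1) (fun _ _ _ => rfl) fun hcl => hne (hp.eq_empty hζ hS hcl (hs.mono hG))
    simpa using h

/-- Comparing `sum_density` with `sum_agreeProb` determines the consistency probability as a power
of q; substituting it normalizes the planted distribution. -/
theorem consistentProb_pos_and_planted_eq [Nonempty Ω] (hτ : 0 < τ)
    (harity : ∀ f, τ - 1 ≤ (I.nbr f).card) (huniform : ∀ f, IsTWiseUniform (τ - 1) (I.μ f))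
    (hp : I.Plausible τ ζ SMALL) (hζ : 0 < ζ) (hS : 0 ≤ SMALL)
    {H : Finset (F × V)} (hH : H ⊆ I.edges) (hs : IsSmall SMALL H) :
    0 < I.consistentProb H ∧ ∀ x, (Fintype.card Ω : ℝ) ^ Fintype.card V * I.planted H x =
      I.density H x := by
  have hq : (0 : ℝ) < Fintype.card Ω := by exact_mod_cast Fintype.card_pos
  have h1 := sum_density hτ harity huniform hp hζ hS hH hs
  simp_rw [density_eq_mul_agreeProb] at h1
  rw [← Finset.mul_sum, sum_agreeProb hH] at h1
  set q : ℝ := ((Fintype.card Ω : ℕ) : ℝ)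
  have ha : 0 < q ^ H.card := pow_pos hq _
  have hb : 0 < q ^ (Fintype.card V - (vbls H).card) := pow_pos hq _
  have hc : 0 < q ^ Fintype.card V := pow_pos hq _
  have hpos : 0 < I.consistentProb H := by
    rw [← h1] at hc
    exact pos_of_mul_pos_left (pos_of_mul_pos_right hc ha.le) hb.le
  refine ⟨hpos, fun x => ?_⟩
  rw [density_eq_mul_agreeProb, planted, show (Fintype.card Ω : ℝ) = q from rfl, ← h1, div_pow,
    one_pow]
  field_simp

/-! ### The pseudoexpectation -/

theorem pseudoexp_monomial (M : (V × Ω) →₀ ℕ) :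
    I.pseudoexp τ SMALL (MvPolynomial.monomial M 1) =
      I.plantedExp (I.cl τ SMALL (monomialVbls M))
        fun x => MvPolynomial.eval (indicatorPoint x) (MvPolynomial.monomial M (1 : ℝ)) := by
  have h : (MvPolynomial.basisMonomials (V × Ω) ℝ) M = MvPolynomial.monomial M 1 := by simp
  rw [pseudoexp, ← h, Module.Basis.constr_basis, h]

/-- The pseudoexpectation is integration against the signed density. -/
theorem pseudoexp_eq_sum_signedDensity [Nonempty Ω] (hτ : 0 < τ)
    (harity : ∀ f, τ - 1 ≤ (I.nbr f).card) (huniform : ∀ f, IsTWiseUniform (τ - 1) (I.μ f))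
    (hp : I.Plausible τ ζ SMALL) (hζ : 0 < ζ) (hS : 0 ≤ SMALL) {p : MvPolynomial (V × Ω) ℝ}
    (hdeg : (mlinDegree p : ℝ) ≤ ζ * SMALL) :
    I.pseudoexp τ SMALL p = ((Fintype.card Ω : ℝ) ^ Fintype.card V)⁻¹ *
      ∑ x, I.signedDensity τ SMALL x * MvPolynomial.eval (indicatorPoint x) p := by
  have hq : (Fintype.card Ω : ℝ) ^ Fintype.card V ≠ 0 :=
    pow_ne_zero _ (by exact_mod_cast Fintype.card_ne_zero)
  have hmon : ∀ M ∈ p.support, I.pseudoexp τ SMALL (MvPolynomial.monomial M 1) =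
      ((Fintype.card Ω : ℝ) ^ Fintype.card V)⁻¹ * ∑ x, I.signedDensity τ SMALL x *
        MvPolynomial.eval (indicatorPoint x) (MvPolynomial.monomial M 1) := by
    intro M hM
    have hcard : ((monomialVbls M).card : ℝ) ≤ ζ * SMALL :=
      le_trans (by exact_mod_cast card_monomialVbls_le_mlinDegree hM) hdeg
    have hs := hp.isSmall_cl_of_card_le hζ hS hcard
    rw [pseudoexp_monomial, I.sum_signedDensity_mul hτ harity huniform
      (dependsOn_eval_monomial M 1) (cl_subset_edges _) hs subset_rfl, plantedExp,
      eq_inv_mul_iff_mul_eq₀ hq, Finset.mul_sum]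
    refine Finset.sum_congr rfl fun x _ => ?_
    rw [← mul_assoc,
      (consistentProb_pos_and_planted_eq hτ harity huniform hp hζ hS (cl_subset_edges _) hs).2]
  conv_lhs => rw [sum_coeff_smul_monomial p]
  rw [map_sum]
  simp_rw [map_smul, smul_eq_mul]
  rw [Finset.sum_congr rfl fun M hM => by rw [hmon M hM]]
  have hev : ∀ x : V → Ω, MvPolynomial.eval (indicatorPoint x) p = ∑ M ∈ p.support,
      p.coeff M * MvPolynomial.eval (indicatorPoint x) (MvPolynomial.monomial M 1) := fun x => by
    conv_lhs => rw [sum_coeff_smul_monomial p]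
    rw [map_sum]
    simp_rw [MvPolynomial.smul_eval]
  simp_rw [hev, Finset.mul_sum]
  rw [Finset.sum_comm]
  exact Finset.sum_congr rfl fun x _ => Finset.sum_congr rfl fun M _ => by ring

theorem pseudoexp_eq_zero_of_eval [Nonempty Ω] (hτ : 0 < τ)
    (harity : ∀ f, τ - 1 ≤ (I.nbr f).card) (huniform : ∀ f, IsTWiseUniform (τ - 1) (I.μ f))
    (hp : I.Plausible τ ζ SMALL) (hζ : 0 < ζ) (hS : 0 ≤ SMALL) {p : MvPolynomial (V × Ω) ℝ}
    (hz : ∀ x, MvPolynomial.eval (indicatorPoint x) p = 0) :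
    SatisfiesIdentity (I.pseudoexp τ SMALL) (ζ * SMALL) p := by
  intro q hq
  rw [pseudoexp_eq_sum_signedDensity hτ harity huniform hp hζ hS
    (le_trans (by exact_mod_cast mlinDegree_le_totalDegree _) hq)]
  simp [hz]

theorem pseudoexp_multilin [Nonempty Ω] (hτ : 0 < τ)
    (harity : ∀ f, τ - 1 ≤ (I.nbr f).card) (huniform : ∀ f, IsTWiseUniform (τ - 1) (I.μ f))
    (hp : I.Plausible τ ζ SMALL) (hζ : 0 < ζ) (hS : 0 ≤ SMALL) {p : MvPolynomial (V × Ω) ℝ}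
    (hdeg : (mlinDegree p : ℝ) ≤ ζ * SMALL) :
    I.pseudoexp τ SMALL p = I.pseudoexp τ SMALL (multilin p) := by
  rw [sum_coeff_smul_monomial p]
  simp_rw [map_sum, map_smul]
  refine Finset.sum_congr rfl fun M hM => ?_
  congr 1
  have hcard : ((monomialVbls M).card : ℝ) ≤ ζ * SMALL :=
    le_trans (by exact_mod_cast card_monomialVbls_le_mlinDegree hM) hdeg
  rw [pseudoexp_eq_sum_signedDensity hτ harity huniform hp hζ hS
    (le_trans (by exact_mod_cast mlinDegree_monomial_le M 1) hcard),
    pseudoexp_eq_sum_signedDensity hτ harity huniform hp hζ hS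
    (p := multilin (MvPolynomial.monomial M 1)) ?_]
  · simp_rw [eval_multilin_monomial]
  · rw [multilin_monomial]
    refine le_trans ?_ hcard
    exact_mod_cast (mlinDegree_monomial_le _ _).trans
      (Finset.card_le_card (monomialVbls_sum_single_subset M))

theorem pseudoexp_sq_nonneg [Nonempty Ω] (hτ : 0 < τ)
    (harity : ∀ f, τ - 1 ≤ (I.nbr f).card) (huniform : ∀ f, IsTWiseUniform (τ - 1) (I.μ f))
    (hp : I.Plausible τ ζ SMALL) (hζ : 0 < ζ) (hS : 0 ≤ SMALL) {D : ℕ}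
    (hD : (D : ℝ) ≤ ζ * SMALL / 3) {p : MvPolynomial (V × Ω) ℝ} (hdeg : p.totalDegree ≤ D) :
    0 ≤ I.pseudoexp τ SMALL (p ^ 2) := by
  have hdeg2 : (mlinDegree (p ^ 2) : ℝ) ≤ ζ * SMALL := by
    have h1 : mlinDegree (p ^ 2) ≤ 2 * D := (mlinDegree_le_totalDegree _).trans
      ((MvPolynomial.totalDegree_pow p 2).trans (Nat.mul_le_mul_left 2 hdeg))
    have h2 : (mlinDegree (p ^ 2) : ℝ) ≤ 2 * D := by exact_mod_cast h1
    have h3 : (0 : ℝ) ≤ D := Nat.cast_nonneg D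
    linarith
  rw [pseudoexp_eq_sum_signedDensity hτ harity huniform hp hζ hS hdeg2]
  refine mul_nonneg (by positivity) ?_
  simp_rw [map_pow]
  refine sum_signedDensity_sq_nonneg hτ harity huniform hp hζ hS
    (Finset.univ.filter fun S : Finset V => S.card ≤ D) ?_ ?_
    (eval_mem_sup_localFunctions p _ fun M hM => ?_)
  · intro S hSD
    have : (S.card : ℝ) ≤ D := by exact_mod_cast (Finset.mem_filter.1 hSD).2
    linarith
  · intro S hSD T hT
    have := (Finset.mem_filter.1 hSD).2
    exact Finset.mem_filter.2 ⟨Finset.mem_univ _, by omega⟩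
  · exact Finset.mem_filter.2 ⟨Finset.mem_univ _, (card_monomialVbls_le_totalDegree hM).trans hdeg⟩

/-! ### The constraints -/

open Classical in
theorem eval_supportPoly (f : F) (x : V → Ω) :
    MvPolynomial.eval (indicatorPoint x) (I.supportPoly f) =
      if (fun i : I.nbr f => x i) ∈ (I.μ f).support then 1 else 0 := by
  have h : ∀ c : I.nbr f → Ω, MvPolynomial.eval (indicatorPoint x)
      (if c ∈ (I.μ f).support then ∏ i : I.nbr f, MvPolynomial.X ((i : V), c i) else 0) =
      if c = (fun i : I.nbr f => x i) then
        (if (fun i : I.nbr f => x i) ∈ (I.μ f).support then 1 else 0) else 0 := by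
    intro c
    rw [apply_ite (MvPolynomial.eval (indicatorPoint x)), map_zero, map_prod]
    simp only [MvPolynomial.eval_X, indicatorPoint]
    rw [Finset.prod_ite_zero]
    by_cases hc : c = fun i : I.nbr f => x i
    · subst hc
      simp
    · have hc' : ¬ ∀ i ∈ (Finset.univ : Finset (I.nbr f)), x i = c i :=
        fun h => hc (funext fun i => (h i (Finset.mem_univ i)).symm)
      rw [if_neg hc, if_neg hc', ite_self]
  rw [supportPoly, map_sum, Finset.sum_congr rfl fun c _ => h c, Finset.sum_ite_eq']
  simp

/-- The summands are monomials with coefficient 1, so nothing cancels, and subtracting 1 affects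
only the constant term. This converts the degree budget for the product into room for N(f). -/
theorem card_nbr_le_totalDegree_supportPoly (f : F) (hne : (I.nbr f).Nonempty) :
    (I.nbr f).card ≤ (I.supportPoly f - 1).totalDegree := by
  classical
  let m : (I.nbr f → Ω) → (V × Ω) →₀ ℕ := fun c => ∑ i : I.nbr f, Finsupp.single ((i : V), c i) 1
  have hprod : ∀ c : I.nbr f → Ω, (∏ i : I.nbr f, MvPolynomial.X ((i : V), c i) :
      MvPolynomial (V × Ω) ℝ) = MvPolynomial.monomial (m c) 1 := fun c => by
    rw [MvPolynomial.monomial_sum_one]; rfl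
  obtain ⟨c₀, hc₀⟩ := (I.μ f).support_nonempty
  have hdeg : (m c₀).degree = (I.nbr f).card := by
    simp [m, map_sum]
  have hm0 : m c₀ ≠ 0 := fun h => by
    rw [h, map_zero] at hdeg
    exact hne.card_pos.ne hdeg
  have hcoeff : 1 ≤ (I.supportPoly f - 1).coeff (m c₀) := by
    rw [MvPolynomial.coeff_sub, MvPolynomial.coeff_one, if_neg hm0.symm, sub_zero, supportPoly,
      MvPolynomial.coeff_sum]
    refine le_trans (b := (if c₀ ∈ (I.μ f).support then
      ∏ i : I.nbr f, MvPolynomial.X ((i : V), c₀ i) else 0 :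
        MvPolynomial (V × Ω) ℝ).coeff (m c₀)) ?_
      (Finset.single_le_sum (f := fun c => (if c ∈ (I.μ f).support then
        ∏ i : I.nbr f, MvPolynomial.X ((i : V), c i) else 0 :
          MvPolynomial (V × Ω) ℝ).coeff (m c₀)) (fun c _ => ?_) (Finset.mem_univ c₀))
    · rw [if_pos hc₀, hprod, MvPolynomial.coeff_monomial, if_pos rfl]
    · split_ifs
      · rw [hprod, MvPolynomial.coeff_monomial]
        split_ifs <;> norm_num
      · simp
  have hmem : m c₀ ∈ (I.supportPoly f - 1).support :=
    MvPolynomial.mem_support_iff.2 (by linarith)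
  rw [← hdeg]
  exact MvPolynomial.le_totalDegree hmem

theorem mem_support_of_marginalDensity_ne_zero {f : F} {x : V → Ω}
    (h : I.marginalDensity f x (I.nbr f) ≠ 0) : (fun i : I.nbr f => x i) ∈ (I.μ f).support := by
  classical
  obtain ⟨w, _, hw⟩ := Finset.exists_ne_zero_of_sum_ne_zero (right_ne_zero_of_mul h)
  rw [ite_ne_right_iff] at hw
  have hx : w = fun i : I.nbr f => x i := funext fun i => hw.1 i i.2
  rw [← hx, PMF.mem_support_iff]
  exact fun h0 => hw.2 (by simp [h0])

/-- The closure of a set that contains the neighbourhood of `f` puts all its mass on assignments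
in the support of `μ f`. -/
theorem mem_support_of_density_ne_zero [Nonempty Ω]
    (harity : ∀ f, τ - 1 ≤ (I.nbr f).card) (huniform : ∀ f, IsTWiseUniform (τ - 1) (I.μ f))
    (hS : 1 ≤ SMALL) {f : F} {S : Finset V} (hfS : I.nbr f ⊆ S) {x : V → Ω}
    (hx : I.density (I.cl τ SMALL S) x ≠ 0) : (fun i : I.nbr f => x i) ∈ (I.μ f).support := by
  apply mem_support_of_marginalDensity_ne_zero
  rcases Nat.lt_or_ge (I.nbr f).card τ with hlt | hge
  -- Here the arity is exactly τ-1, so μ_f itself is uniform.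
  · rw [I.marginalDensity_eq_one (harity f) (huniform f) subset_rfl (by omega)]
    exact one_ne_zero
  · have hstar : ({f} ×ˢ I.nbr f : Finset (F × V)) ⊆ I.cl τ SMALL S := by
      have hcons : cons ({f} ×ˢ I.nbr f : Finset (F × V)) ⊆ {f} := fun g hg => by
        obtain ⟨i, hi⟩ := mem_cons_iff.1 hg
        exact (Finset.mem_product.1 hi).1
      have hτ : I.IsTauSubgraph τ ({f} ×ˢ I.nbr f) := by
        refine ⟨fun e he => ?_, fun g hg => ?_⟩
        · obtain ⟨h1, h2⟩ := Finset.mem_product.1 he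
          rw [mem_edges, Finset.mem_singleton.1 h1]
          exact h2
        · obtain rfl := Finset.mem_singleton.1 (hcons hg)
          rw [← card_nbrIn]
          refine hge.trans (Finset.card_le_card fun i hi => ?_)
          exact mem_nbrIn.2 (Finset.mem_product.2 ⟨Finset.mem_singleton_self _, hi⟩)
      refine I.subset_cl (isClosedSubgraph_of_vbls_subset hτ fun i hi => ?_) ?_
      · obtain ⟨g, hg⟩ := mem_vbls_iff.1 hi
        exact hfS (Finset.mem_product.1 hg).2
      · refine le_trans ?_ hS
        exact_mod_cast Finset.card_le_card hcons
    have hnbr : nbrIn (I.cl τ SMALL S) f = I.nbr f := by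
      refine (nbrIn_subset_nbr (cl_subset_edges S) f).antisymm fun i hi => ?_
      exact mem_nbrIn.2 (hstar (Finset.mem_product.2 ⟨Finset.mem_singleton_self _, hi⟩))
    rw [← hnbr]
    exact Finset.prod_ne_zero_iff.1 hx f (Finset.mem_univ f)

theorem satisfiesIdentity_supportPoly [Nonempty Ω] (hτ : 2 ≤ τ)
    (harity : ∀ f, τ - 1 ≤ (I.nbr f).card) (huniform : ∀ f, IsTWiseUniform (τ - 1) (I.μ f))
    (hp : I.Plausible τ ζ SMALL) (hζ : 0 < ζ) (hS : 1 ≤ SMALL) (f : F) :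
    SatisfiesIdentity (I.pseudoexp τ SMALL) (ζ * SMALL) (I.supportPoly f - 1) := by
  classical
  intro q hq
  have hτ0 : 0 < τ := by omega
  have hS0 : 0 ≤ SMALL := by linarith
  have hne : (I.nbr f).Nonempty := Finset.card_pos.1 (by have := harity f; omega)
  have hcard := card_nbr_le_totalDegree_supportPoly f hne
  rcases eq_or_ne q 0 with rfl | hq0
  · simp
  have hp0 : I.supportPoly f - 1 ≠ 0 := fun h => by
    rw [h, MvPolynomial.totalDegree_zero] at hcard
    have := hne.card_pos
    omega
  rw [pseudoexp_eq_sum_signedDensity hτ0 harity huniform hp hζ hS0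
    (le_trans (by exact_mod_cast mlinDegree_le_totalDegree _) hq)]
  -- Exact additivity of degrees ensures that N(f) together with the variables of any monomial of q
  -- stays within ζ·`SMALL`.
  rw [MvPolynomial.totalDegree_mul_of_isDomain hp0 hq0] at hq
  have hsum : ∀ x : V → Ω, MvPolynomial.eval (indicatorPoint x) ((I.supportPoly f - 1) * q) =
      ∑ M ∈ q.support, MvPolynomial.eval (indicatorPoint x) (I.supportPoly f - 1) *
        MvPolynomial.eval (indicatorPoint x) (MvPolynomial.monomial M (q.coeff M)) := fun x => by
    rw [map_mul, ← Finset.mul_sum, ← map_sum, ← q.as_sum]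
  refine mul_eq_zero_of_right _ ?_
  simp_rw [hsum, Finset.mul_sum]
  rw [Finset.sum_comm]
  refine Finset.sum_eq_zero fun M hM => ?_
  have hSc : ((I.nbr f ∪ monomialVbls M).card : ℝ) ≤ ζ * SMALL := by
    refine le_trans ?_ hq
    exact_mod_cast (Finset.card_union_le _ _).trans
      (Nat.add_le_add hcard (card_monomialVbls_le_totalDegree hM))
  have hdep : DependsOn (fun x : V → Ω =>
      MvPolynomial.eval (indicatorPoint x) (I.supportPoly f - 1) *
        MvPolynomial.eval (indicatorPoint x) (MvPolynomial.monomial M (q.coeff M)))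
      (I.nbr f ∪ monomialVbls M : Finset V) := by
    intro x y h
    have h1 : (fun i : I.nbr f => x i) = fun i : I.nbr f => y i :=
      funext fun i => h i (Finset.mem_coe.2 (Finset.mem_union_left _ i.2))
    have h2 := dependsOn_eval_monomial M (q.coeff M) (x := x) (y := y)
      fun i hi => h i (Finset.mem_coe.2 (Finset.mem_union_right _ hi))
    simp only [map_sub, eval_supportPoly, h1] at h2 ⊢
    rw [h2, map_one, map_one]
  rw [I.sum_signedDensity_mul hτ0 harity huniform hdep (cl_subset_edges _)
    (hp.isSmall_cl_of_card_le hζ hS0 hSc) subset_rfl]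
  refine Finset.sum_eq_zero fun x _ => ?_
  by_cases hx : I.density (I.cl τ SMALL (I.nbr f ∪ monomialVbls M)) x = 0
  · rw [hx, zero_mul]
  · have := mem_support_of_density_ne_zero harity huniform hS Finset.subset_union_left hx
    rw [map_sub, eval_supportPoly, if_pos this, map_one, sub_self, zero_mul, mul_zero]

end CSPInstance

/-! ### Assembly of the theorem. -/

theorem theorem7p6 {V F Ω : Type*} [Fintype V] [DecidableEq V] [Fintype F] [DecidableEq F]
    [Fintype Ω] [DecidableEq Ω] [Nontrivial Ω]
    (K τ : ℕ) (hτ : 3 ≤ τ) (hτK : τ ≤ K)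
    (ζ SMALL : ℝ) (hζ0 : 0 < ζ) (hζ1 : ζ < 1)
    (hSMALL1 : 1 ≤ SMALL) (hSMALLn : SMALL ≤ (Fintype.card V : ℝ) / 2)
    (hK : (K : ℝ) ≤ ζ * SMALL)
    (I : CSPInstance V F Ω)
    (harity : ∀ f, τ - 1 ≤ (I.nbr f).card ∧ (I.nbr f).card ≤ K)
    (huniform : ∀ f, IsTWiseUniform (τ - 1) (I.μ f))
    (hplausible : I.Plausible τ ζ SMALL) :
    -- the pseudoexpectation is well-defined up to multilinear-degree `ζ * SMALL`
    (∀ S : Finset V, (S.card : ℝ) ≤ ζ * SMALL →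
      IsSmall SMALL (I.cl τ SMALL S) ∧ 0 < I.consistentProb (I.cl τ SMALL S)) ∧
    I.pseudoexp τ SMALL 1 = 1 ∧
    -- positive semidefiniteness
    (∀ D : ℕ, (D : ℝ) ≤ ζ * SMALL / 3 →
      ∀ p : MvPolynomial (V × Ω) ℝ, p.totalDegree ≤ D → 0 ≤ I.pseudoexp τ SMALL (p ^ 2)) ∧
    -- the identities expressing that exactly one symbol is assigned to each variable
    (∀ i : V, SatisfiesIdentity (I.pseudoexp τ SMALL) (ζ * SMALL)
      ((∑ c : Ω, MvPolynomial.X (i, c)) - 1)) ∧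
    (∀ (i : V) (c : Ω), SatisfiesIdentity (I.pseudoexp τ SMALL) (ζ * SMALL)
      (MvPolynomial.X (i, c) ^ 2 - MvPolynomial.X (i, c))) ∧
    (∀ p : MvPolynomial (V × Ω) ℝ, (mlinDegree p : ℝ) ≤ ζ * SMALL →
      I.pseudoexp τ SMALL p = I.pseudoexp τ SMALL (multilin p)) ∧
    -- the assignment to the neighbours of every constraint lies in the support of `μ f`
    (∀ f : F, SatisfiesIdentity (I.pseudoexp τ SMALL) (ζ * SMALL) (I.supportPoly f - 1)) := by

  have hτ0 : 0 < τ := by omega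
  have hS0 : 0 ≤ SMALL := by linarith
  have har : ∀ f, τ - 1 ≤ (I.nbr f).card := fun f => (harity f).1
  refine ⟨fun S hS => ?_, ?_, fun D hD p hdeg => ?_, fun i => ?_, fun i c => ?_, fun p hdeg => ?_,
    fun f => ?_⟩
  · have hs := hplausible.isSmall_cl_of_card_le hζ0 hS0 hS
    exact ⟨hs, (CSPInstance.consistentProb_pos_and_planted_eq hτ0 har huniform hplausible hζ0 hS0
      (CSPInstance.cl_subset_edges S) hs).1⟩
  · have hs := hplausible.isSmall_cl_of_card_le hζ0 hS0 (T := ∅)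
      (by simpa using mul_nonneg hζ0.le hS0)
    rw [CSPInstance.pseudoexp_eq_sum_signedDensity hτ0 har huniform hplausible hζ0 hS0
      (le_trans (Nat.cast_le.2 (mlinDegree_le_totalDegree _))
        (by simpa using mul_nonneg hζ0.le hS0))]
    rw [I.sum_signedDensity_mul hτ0 har huniform (S := ∅) (fun _ _ _ => by simp)
      (CSPInstance.cl_subset_edges _) hs subset_rfl]
    simp only [map_one, mul_one]
    rw [CSPInstance.sum_density hτ0 har huniform hplausible hζ0 hS0
      (CSPInstance.cl_subset_edges _) hs]
    exact inv_mul_cancel₀ (pow_ne_zero _ (by exact_mod_cast Fintype.card_ne_zero))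
  · exact CSPInstance.pseudoexp_sq_nonneg hτ0 har huniform hplausible hζ0 hS0 hD hdeg
  · refine CSPInstance.pseudoexp_eq_zero_of_eval hτ0 har huniform hplausible hζ0 hS0 fun x => ?_
    simp [indicatorPoint]
  · refine CSPInstance.pseudoexp_eq_zero_of_eval hτ0 har huniform hplausible hζ0 hS0 fun x => ?_
    -- The indicator takes only the values 0 and 1, both idempotent.
    by_cases h : x i = c <;> simp [indicatorPoint, h]
  · exact CSPInstance.pseudoexp_multilin hτ0 har huniform hplausible hζ0 hS0 hdeg
  · exact CSPInstance.satisfiesIdentity_supportPoly (by omega) har huniform hplausible hζ0 hSMALL1 f
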